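/- **Setting.** Consider a first-price sealed-bid auction with $n\ge 2$ risk-neutral bidders. The highest bid wins and pays its bid, and ties are broken uniformly. A bidder with value $v$ who wins with bid $b$ gets $v-b$, and a loser gets $0$. Values are i.i.d. with distribution $F$, whose support has lowest point $\underline v$ and highest point $\overline v$, where $0\le\underline v<\overline v<\infty$. For a joint distribution $B_{-i}$ of the opponents' bids let $U_i(b,B_{-i}\mid v)$ be the expected utility of bidding $b$ with value $v$, and let $$\lambda_i(b,B_{-i}\mid v)=\sup_{\tilde b\ge 0}U_i(\tilde b,B_{-i}\mid v)-U_i(b,B_{-i}\mid v)$$ be the loss of $b$. Given beliefs $(l_i,\mu_i,u_i)$ with $0\le l_i<u_i$, bidder $i$ considers possible every profile of independent opponent bid distributions $B_j$, $j\ne i$ (not necessarily identical), each with $B_j([l_i,u_i])=1$ and $\int x\,dB_j(x)=\mu_i$. Let $\mathcal B_i(l_i,\mu_i,u_i)$ be the set of these profiles. A tuple $(\beta,l,\mu,u)$ of measurable strategies $\beta_i:\operatorname{supp}F\to[0,\infty)$ and beliefs $(l_i,\mu_i,u_i)$ is an *(individual) moment equilibrium* if 1. for all $i$ and all $v\in\operatorname{supp}F$,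 the bid $\beta_i(v)$ minimizes $\sup_{B_{-i}\in\mathcal B_i(l_i,\mu_i,u_i)}\lambda_i(b,B_{-i}\mid v)$ over $b\ge 0$; 2. $\int\beta_i\,dF=\mu_j$ for all $i\ne j$; 3. $\inf_{v\in\operatorname{supp}F}\beta_i(v)=l_j$ and $\sup_{v\in\operatorname{supp}F}\beta_i(v)=u_j$ for all $i\neq j$. For $l<\mu<u$ and $v\ge l$, the bidding function $\beta^{\mathrm{IND}}(v\mid l,\mu,u)$ is defined as follows. * If $n=2$, set $\hat v_1=\frac{u(\mu-l)+\mu(u-\mu)}{u-l}$ and $\hat v_2=\frac{u(u-l)-l(u-\mu)}{\mu-l}$. Then $\beta^{\mathrm{IND}}$ equals $u-\sqrt{(u-l)(u-v)}$ if $v<\hat v_1$, equals $$l+\frac{-(\mu-l)(u-l)+\sqrt{(\mu-l)(u-l)\big((4v-3l)(u-\mu)+u(\mu-l)-l(u-l)\big)}}{2(u-\mu)}$$ if $\hat v_1\le v<\hat v_2$, and equals $u$ if $v\ge\hat v_2$. * If $n\ge3$, set $\tilde x_1(b)=\max\{l,\min\{\mu,\frac{(n-1)b-u}{n-2}\}\}$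 and $\Lambda(b)=\left(\frac{u-\mu}{u-\tilde x_1(b)}\right)^{n-1}(b-\tilde x_1(b))$. Then $\beta^{\mathrm{IND}}=\min\{b,u\}$. If $v\le\mu+(\mu-\tilde x_1(\mu))\left(\frac{u-\mu}{u-\tilde x_1(\mu)}\right)^{n-1}$, here $b$ is the unique solution in $[l,\mu]$ of $\Lambda(b)=\left(\frac{u-\mu}{u-b}\right)^{n-1}(v-b)$. For higher $v$, it is the unique solution in $[\mu,v]$ of $\Lambda(b)=(v-b)\left(1-\left(\frac{b-\mu}{b-l}\right)^{n-1}\right)$. **Theorem.** For every $n\ge2$ and every value distribution $F$ as above there are common beliefs $(l^\star,\mu^\star,u^\star)$ such that the symmetric tuple in which every bidder uses $\beta^{\mathrm{IND}}(\cdot\mid l^\star,\mu^\star,u^\star)$ and has beliefs $(l^\star,\mu^\star,u^\star)$ is a moment equilibrium, and $v\mapsto\beta^{\mathrm{IND}}(v\mid l^\star,\mu^\star,u^\star)$ is strictly increasing on $[\underline v,\overline v]$. -/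

import Mathlib

open MeasureTheory

namespace FirstPriceAuction

/-- Ex-post expected utility of bidder `i` with value `v` in the `n`-bidder first-price auction, at the
profile of bids `b`: the highest bid wins and pays its bid, ties are broken uniformly. -/
noncomputable def payoff {n : ℕ} (i : Fin n) (v : ℝ) (b : Fin n → ℝ) : ℝ :=
  open Classical in
  if ∀ j, b j ≤ b i then (v - b i) / ((Finset.univ.filter fun j => b j = b i).card : ℝ) else 0

/-- The profile of bids in which `i` bids `bi` and the opponents bid `b`. -/
def profile {n : ℕ} (i : Fin n) (bi : ℝ) (b : {j : Fin n // j ≠ i} → ℝ) : Fin n → ℝ :=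
  fun j => if h : j = i then bi else b ⟨j, h⟩

/-- Interim expected utility of the bid `bi` against the joint distribution `P` of opponent bids. -/
noncomputable def expectedUtility {n : ℕ} (i : Fin n) (v bi : ℝ)
    (P : Measure ({j : Fin n // j ≠ i} → ℝ)) : ℝ :=
  ∫ b, payoff i v (profile i bi b) ∂P

/-- The loss of the bid `bi`: best possible expected utility (over nonnegative bids) minus the expected
utility of `bi`. -/
noncomputable def loss {n : ℕ} (i : Fin n) (v bi : ℝ)
    (P : Measure ({j : Fin n // j ≠ i} → ℝ)) : EReal :=
  (⨆ b' ∈ Set.Ici (0 : ℝ), (expectedUtility i v b' P : EReal)) - (expectedUtility i v bi P : EReal)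

/-- The bid distributions of a single opponent that are possible under the range belief `[l, u]` and the
individual moment belief `μ`. -/
def singleBeliefSet (l μ u : ℝ) : Set (Measure ℝ) :=
  {B | IsProbabilityMeasure B ∧ B (Set.Icc l u) = 1 ∧ ∫ x, x ∂B = μ}

/-- The belief set of bidder `i`: opponents bid independently, each from some (not necessarily the same)
possible bid distribution. -/
def beliefSet {n : ℕ} (i : Fin n) (l μ u : ℝ) : Set (Measure ({j : Fin n // j ≠ i} → ℝ)) :=
  {P | ∃ B : {j : Fin n // j ≠ i} → Measure ℝ,
    (∀ j, B j ∈ singleBeliefSet l μ u) ∧ P = Measure.pi B}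

/-- The maximal loss of the bid `bi`. -/
noncomputable def maxLoss {n : ℕ} (i : Fin n) (l μ u v bi : ℝ) : EReal :=
  ⨆ P ∈ beliefSet i l μ u, loss i v bi P

/-- `bi` is a minimax-loss bid: it minimizes the maximal loss over all nonnegative bids. -/
def IsMinimaxBid {n : ℕ} (i : Fin n) (l μ u v bi : ℝ) : Prop :=
  0 ≤ bi ∧ ∀ b', 0 ≤ b' → maxLoss i l μ u v bi ≤ maxLoss i l μ u v b'

/-- `(β, l, μ, u)` is an (individual) moment equilibrium of the `n`-bidder auction with value
distribution `F`. Strategies are functions on the support of `F`; values of `β i` off the support play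
no role. -/
structure IsMomentEquilibrium {n : ℕ} (F : Measure ℝ) (β : Fin n → ℝ → ℝ) (l μ u : Fin n → ℝ) :
    Prop where
  /-- Range beliefs are nondegenerate intervals of nonnegative bids. -/
  range_belief : ∀ i, 0 ≤ l i ∧ l i < u i
  /-- Strategies are Borel measurable. -/
  measurable : ∀ i, Measurable fun v : F.support => β i v
  /-- Each value in the support bids so as to minimize the maximal loss. -/
  minimax : ∀ i, ∀ v ∈ F.support, IsMinimaxBid i (l i) (μ i) (u i) v (β i v)
  /-- Moment beliefs are consistent (the integral converges, by the other conditions). -/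
  moment : ∀ i j, j ≠ i → ∫ v, β i v ∂F = μ j
  /-- The lower range beliefs are consistent. -/
  lower : ∀ i j, j ≠ i → IsGLB (β i '' F.support) (l j)
  /-- The upper range beliefs are consistent. -/
  upper : ∀ i j, j ≠ i → IsLUB (β i '' F.support) (u j)

/-- For `n ≥ 3`: the lower point of the worst-case two-point distribution when `b` is too high. -/
noncomputable def xTilde (n : ℕ) (l μ u b : ℝ) : ℝ :=
  max l (min μ ((((n : ℝ) - 1) * b - u) / ((n : ℝ) - 2)))

/-- For `n ≥ 3`: the maximal loss from bidding too high, as a function of the bid `b`. -/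
noncomputable def lossHigh (n : ℕ) (l μ u b : ℝ) : ℝ :=
  ((u - μ) / (u - xTilde n l μ u b)) ^ (n - 1) * (b - xTilde n l μ u b)

/-- For `n ≥ 3`: values up to this cutoff bid at most `μ`. -/
noncomputable def cutoff (n : ℕ) (l μ u : ℝ) : ℝ :=
  μ + (μ - xTilde n l μ u μ) * ((u - μ) / (u - xTilde n l μ u μ)) ^ (n - 1)

/-- The minimax bidding function for two bidders, in closed form. -/
noncomputable def betaTwo (l μ u v : ℝ) : ℝ :=
  if v < (u * (μ - l) + μ * (u - μ)) / (u - l) then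
    u - √((u - l) * (u - v))
  else if v < (u * (u - l) - l * (u - μ)) / (μ - l) then
    l + (-((μ - l) * (u - l)) +
      √((μ - l) * (u - l) * ((4 * v - 3 * l) * (u - μ) + u * (μ - l) - l * (u - l)))) /
        (2 * (u - μ))
  else u

/-- For `n ≥ 3`: the (unique) solution of the equation that equates the maximal loss of bidding too high
with the maximal loss of bidding too low. It is located in `[l, μ]` for values up to the cutoff and in
`[μ, v]` for higher values. -/
noncomputable def bidSolution (n : ℕ) (l μ u v : ℝ) : ℝ :=
  if v ≤ cutoff n l μ u then
    Classical.epsilon fun b => b ∈ Set.Icc l μ ∧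
      lossHigh n l μ u b = ((u - μ) / (u - b)) ^ (n - 1) * (v - b)
  else
    Classical.epsilon fun b => b ∈ Set.Icc μ v ∧
      lossHigh n l μ u b = (v - b) * (1 - ((b - μ) / (b - l)) ^ (n - 1))

/-- The minimax bidding function `β^IND(v | l, μ, u)` with `n ≥ 2` bidders (meant for
`l < μ < u` and `l ≤ v`). -/
noncomputable def betaIND (n : ℕ) (l μ u v : ℝ) : ℝ :=
  if n = 2 then betaTwo l μ u v else min (bidSolution n l μ u v) u

end FirstPriceAuction

/-! Fix beliefs l < μ < u. A bid b can be too high or too low. It is too high in the worst way when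
every opponent mixes between some x ≤ μ and u: with probability ((u - μ)/(u - x))^(n-1) the bid x
would have won as well, saving b - x. The maximum over x is `overLoss`, which does not depend on v.
It is too low in the worst way when the opponents mix between b and u (if b ≤ μ), or between l and a
point just above b (if b ≥ μ). The minimax bid equates the two losses. Solved for v, that equation
is explicit, `valueOf b = v`, so the argument works with `valueOf`, which is strictly increasing,
and recovers `betaIND` as its inverse (`betaIND_spec`).

Minimaxity: a Markov bound for each opponent, multiplied over independent opponents, shows that b
loses at most `overLoss` (`expectedUtility_le_add_overLoss`). Against any other bid, some i.i.d.
profile of two-point or degenerate distributions, or a limit of such profiles, forces at least that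
loss.

Consistency: the lowest value bids l, so l must be the lowest value. With s = (u - μ)/(u - l), the
requirement that the highest value bids u determines u and μ from s ∈ (0, 1). It remains to make the
average bid equal to μ. Both are continuous in s; as s → 0 the mean belief tends to the highest
value and is too large, while for s near 1 it is too small. The intermediate value theorem finishes
the proof. -/

namespace FirstPriceAuction

/-! ### Calculus of the two losses and inversion of the bidding function -/

open Set

/-- A consequence of Bernoulli's inequality: `y ↦ (y - c) / y ^ m` is unimodal. -/
theorem sub_mul_pow_le {m : ℕ} {y y₀ c : ℝ} (hy₀ : 0 < y₀) (hy : 0 ≤ y) (hc : c ≤ y₀)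
    (h : 0 ≤ (y - y₀) * (((m : ℝ) - 1) * y₀ - m * c)) :
    (y - c) * y₀ ^ m ≤ (y₀ - c) * y ^ m := by
  have hB : 1 + (m : ℝ) * (y / y₀ - 1) ≤ (1 + (y / y₀ - 1)) ^ m :=
    one_add_mul_le_pow (by have := div_nonneg hy hy₀.le; linarith) m
  rw [add_sub_cancel, div_pow, le_div_iff₀ (by positivity)] at hB
  -- The sign condition `h` is exactly what puts y - c below y₀ - c times the Bernoulli tangent
  -- line.
  have h1 : y - c ≤ (y₀ - c) * (1 + (m : ℝ) * (y / y₀ - 1)) := by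
    have : (y₀ - c) * (1 + (m : ℝ) * (y / y₀ - 1)) - (y - c)
        = (y - y₀) * (((m : ℝ) - 1) * y₀ - m * c) / y₀ := by
      field_simp; ring
    have h2 := div_nonneg h hy₀.le
    linarith
  calc (y - c) * y₀ ^ m ≤ (y₀ - c) * (1 + (m : ℝ) * (y / y₀ - 1)) * y₀ ^ m := by gcongr
    _ = (y₀ - c) * ((1 + (m : ℝ) * (y / y₀ - 1)) * y₀ ^ m) := by ring
    _ ≤ _ := mul_le_mul_of_nonneg_left hB (by linarith)

/-- The increment from s to t factors as (t - s)(1 - (1 - t)S + s^m) with S the mixed geometric sum,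
and (1 - t)S ≤ 1 - t^m < 1. This drives the monotonicity of `valueOf` below μ. -/
theorem strictMonoOn_sub_pow_add_pow (m : ℕ) :
    StrictMonoOn (fun t : ℝ => t - t ^ m * (1 - t)) (Icc 0 1) := by
  intro s hs t ht hst
  have ht0 : 0 < t := hs.1.trans_lt hst
  have e1 := (Commute.all t s).geom_sum₂_mul m
  have h1 : (∑ i ∈ Finset.range m, t ^ i * s ^ (m - 1 - i)) ≤ ∑ i ∈ Finset.range m, t ^ i := by
    refine Finset.sum_le_sum fun i _ => ?_
    exact mul_le_of_le_one_right (by positivity) (pow_le_one₀ hs.1 hs.2)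
  have h2 := mul_neg_geom_sum t m
  have h3 : (1 - t) * (∑ i ∈ Finset.range m, t ^ i * s ^ (m - 1 - i)) ≤ 1 - t ^ m := by
    rw [← h2]; exact mul_le_mul_of_nonneg_left h1 (by linarith [ht.2])
  have h4 : 0 < t ^ m := by positivity
  have h5 : 0 ≤ s ^ m := pow_nonneg hs.1 m
  set S := ∑ i ∈ Finset.range m, t ^ i * s ^ (m - 1 - i)
  have key : (t - t ^ m * (1 - t)) - (s - s ^ m * (1 - s))
      = (t - s) * (1 - (1 - t) * S + s ^ m) := by
    linear_combination (1 - t) * e1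
  have : 0 < (t - s) * (1 - (1 - t) * S + s ^ m) := mul_pos (by linarith) (by linarith)
  simp only
  linarith

/-- The lower point of the worst-case two-point distribution when `b` is too high, for any `n ≥ 2`. -/
noncomputable def lowPoint (n : ℕ) (l μ u b : ℝ) : ℝ :=
  if n = 2 then l else xTilde n l μ u b

/-- The maximal loss from bidding too high, for any `n ≥ 2`. -/
noncomputable def overLoss (n : ℕ) (l μ u b : ℝ) : ℝ :=
  ((u - μ) / (u - lowPoint n l μ u b)) ^ (n - 1) * (b - lowPoint n l μ u b)

/-- The value for which the bid `b` equates the maximal losses from bidding too high and too low. -/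
noncomputable def valueOf (n : ℕ) (l μ u b : ℝ) : ℝ :=
  b + overLoss n l μ u b * ((u - min b μ) / (u - μ)) ^ (n - 1) /
    (1 - ((max b μ - μ) / (max b μ - l)) ^ (n - 1))

section

variable {n : ℕ} {l μ u b : ℝ}

theorem le_lowPoint (n : ℕ) (l μ u b : ℝ) : l ≤ lowPoint n l μ u b := by
  unfold lowPoint xTilde
  split_ifs
  exacts [le_rfl, le_max_left _ _]

theorem lowPoint_le_mean (hlμ : l ≤ μ) : lowPoint n l μ u b ≤ μ := by
  unfold lowPoint xTilde
  split_ifs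
  exacts [hlμ, max_le hlμ (min_le_left _ _)]

theorem natCast_sub_two_pos (hn : 2 ≤ n) (h2 : n ≠ 2) : (0 : ℝ) < (n : ℝ) - 2 := by
  have : 3 ≤ n := by omega
  have : (3 : ℝ) ≤ n := by exact_mod_cast this
  linarith

theorem lowPoint_le_self (hn : 2 ≤ n) (hlμ : l ≤ μ) (hμu : μ ≤ u) (hb : l ≤ b) :
    lowPoint n l μ u b ≤ b := by
  rcases le_total b u with hbu | hbu
  · unfold lowPoint xTilde
    split_ifs with h2
    · exact hb
    · have h := natCast_sub_two_pos hn h2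
      refine max_le hb ((min_le_right _ _).trans ?_)
      rw [div_le_iff₀ h]
      nlinarith
  · exact (lowPoint_le_mean hlμ).trans (hμu.trans hbu)

/-- First-order optimality of `lowPoint`. -/
theorem lowPoint_optimal (hn : 2 ≤ n) (hlμ : l ≤ μ) (hbu : n ≠ 2 ∨ b ≤ u) {x : ℝ}
    (hx : x ∈ Icc l μ) :
    (x - lowPoint n l μ u b) * (((n : ℝ) - 1) * b - u - ((n : ℝ) - 2) * lowPoint n l μ u b) ≤ 0 := by
  unfold lowPoint xTilde
  split_ifs with h2
  · subst h2
    have := hbu.resolve_left (by simp)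
    have hx1 := hx.1
    push_cast
    nlinarith
  · have h := natCast_sub_two_pos hn h2
    set z := (((n : ℝ) - 1) * b - u) / ((n : ℝ) - 2) with hz
    have e : ((n : ℝ) - 1) * b - u = ((n : ℝ) - 2) * z := by rw [hz]; field_simp
    rw [e, ← mul_sub, mul_left_comm]
    refine mul_nonpos_of_nonneg_of_nonpos h.le ?_
    obtain ⟨h1, h2⟩ := hx
    rcases le_total μ z with h3 | h3
    · rw [min_eq_left h3, max_eq_right hlμ]; nlinarith
    · rw [min_eq_right h3]
      rcases le_total l z with h4 | h4
      · rw [max_eq_right h4]; simp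
      · rw [max_eq_left h4]; nlinarith

/-- In y = u - x the objective is a multiple of (y - (u - b)) / y^(n-1), so `sub_mul_pow_le` makes
`lowPoint` its maximizer. For n = 2 the maximizer is the endpoint l only when b ≤ u; for n ≥ 3 no
bound on b is needed, which matters in `betaIND_spec`. -/
theorem le_overLoss (hn : 2 ≤ n) (hlμ : l ≤ μ) (hμu : μ < u) (hb : l ≤ b) (hbu : n ≠ 2 ∨ b ≤ u)
    {x : ℝ} (hx : x ∈ Icc l μ) :
    ((u - μ) / (u - x)) ^ (n - 1) * (b - x) ≤ overLoss n l μ u b := by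
  unfold overLoss
  have h1 := lowPoint_optimal hn hlμ hbu hx
  have h2 := lowPoint_le_self hn hlμ hμu.le hb
  have h3 : lowPoint n l μ u b ≤ μ := lowPoint_le_mean hlμ
  set z := lowPoint n l μ u b
  have hc : ((n - 1 : ℕ) : ℝ) = (n : ℝ) - 1 := by push_cast [Nat.cast_sub (by omega : 1 ≤ n)]; ring
  have hx2 := hx.2
  have key := sub_mul_pow_le (m := n - 1) (y := u - x) (y₀ := u - z) (c := u - b)
    (by linarith) (by linarith) (by linarith) (by rw [hc]; nlinarith)
  have p1 : 0 < u - x := by linarith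
  have p2 : 0 < u - z := by linarith
  rw [div_pow, div_pow, div_mul_eq_mul_div, div_mul_eq_mul_div, div_le_div_iff₀ (by positivity)
    (by positivity), mul_assoc, mul_assoc]
  refine mul_le_mul_of_nonneg_left ?_ (pow_nonneg (by linarith) _)
  simpa using key

theorem overLoss_nonneg (hn : 2 ≤ n) (hlμ : l ≤ μ) (hμu : μ < u) (hb : l ≤ b) :
    0 ≤ overLoss n l μ u b := by
  have h2 := lowPoint_le_self hn hlμ hμu.le hb
  have h3 : lowPoint n l μ u b ≤ μ := lowPoint_le_mean hlμ
  exact mul_nonneg (pow_nonneg (div_nonneg (by linarith) (by linarith)) _) (by linarith)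

/-- Envelope argument: the low point optimal for b is still available at b', and with it frozen the
loss is strictly increasing in the bid. -/
theorem overLoss_lt (hn : 2 ≤ n) (hlμ : l ≤ μ) (hμu : μ < u) (hb : l ≤ b) {b' : ℝ} (hbb : b < b')
    (hbu : n ≠ 2 ∨ b' ≤ u) : overLoss n l μ u b < overLoss n l μ u b' := by
  have h3 : lowPoint n l μ u b ≤ μ := lowPoint_le_mean hlμ
  refine lt_of_lt_of_le ?_ (le_overLoss hn hlμ hμu (hb.trans hbb.le) hbu
    ⟨le_lowPoint n l μ u b, h3⟩)
  exact mul_lt_mul_of_pos_left (by linarith) (pow_pos (div_pos (by linarith) (by linarith)) _)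

theorem overLoss_le_sub (hn : 2 ≤ n) (hlμ : l ≤ μ) (hμu : μ < u) (hb : l ≤ b) :
    overLoss n l μ u b ≤ b - l := by
  have h1 := le_lowPoint n l μ u b
  have h2 := lowPoint_le_self hn hlμ hμu.le hb
  have h3 : lowPoint n l μ u b ≤ μ := lowPoint_le_mean hlμ
  refine (mul_le_of_le_one_left (by linarith) (pow_le_one₀ (div_nonneg (by linarith) (by linarith))
    ((div_le_one (by linarith)).2 (by linarith)))).trans (by linarith)

theorem overLoss_le_upper (hn : 2 ≤ n) (hlμ : l ≤ μ) (hμu : μ < u) (hb : l ≤ b) (hbu : b ≤ u) :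
    overLoss n l μ u b ≤ u - μ := by
  have h2 := lowPoint_le_self hn hlμ hμu.le hb
  have h3 : lowPoint n l μ u b ≤ μ := lowPoint_le_mean hlμ
  unfold overLoss
  set z := lowPoint n l μ u b
  have hz : 0 < u - z := by linarith
  have h0 : 0 ≤ (u - μ) / (u - z) := div_nonneg (by linarith) hz.le
  have h1 : (u - μ) / (u - z) ≤ 1 := (div_le_one hz).2 (by linarith)
  calc ((u - μ) / (u - z)) ^ (n - 1) * (b - z) ≤ ((u - μ) / (u - z)) ^ 1 * (u - z) := by
        refine mul_le_mul (pow_le_pow_of_le_one h0 h1 (by omega)) (by linarith) (by linarith)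
          (by positivity)
    _ = u - μ := by rw [pow_one]; field_simp

theorem overLoss_upper (hn : 2 ≤ n) (hlμ : l ≤ μ) (hμu : μ < u) : overLoss n l μ u u = u - μ := by
  refine le_antisymm (overLoss_le_upper hn hlμ hμu (by linarith) le_rfl) ?_
  have := le_overLoss (b := u) hn hlμ hμu (by linarith) (Or.inr le_rfl) ⟨hlμ, le_rfl⟩
  rwa [div_self (by linarith), one_pow, one_mul] at this

theorem overLoss_lower (hn : 2 ≤ n) (hlμ : l ≤ μ) (hμu : μ < u) : overLoss n l μ u l = 0 :=
  le_antisymm (by simpa using overLoss_le_sub (b := l) hn hlμ hμu le_rfl)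
    (overLoss_nonneg hn hlμ hμu le_rfl)

/-- The truncations in `valueOf` glue two regimes into one continuous formula: below μ the
denominator is 1, above μ the power factor is 1. -/
theorem valueOf_of_le (hn : 2 ≤ n) (hb : b ≤ μ) :
    valueOf n l μ u b = b + overLoss n l μ u b * ((u - b) / (u - μ)) ^ (n - 1) := by
  simp [valueOf, min_eq_left hb, max_eq_right hb, show n - 1 ≠ 0 by omega]

theorem valueOf_of_ge (hμu : μ < u) (hb : μ ≤ b) :
    valueOf n l μ u b = b + overLoss n l μ u b / (1 - ((b - μ) / (b - l)) ^ (n - 1)) := by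
  simp [valueOf, min_eq_right hb, max_eq_left hb, div_self (by linarith : u - μ ≠ 0)]

theorem one_sub_pow_pos (hn : 2 ≤ n) (hlμ : l < μ) (hb : μ ≤ b) :
    0 < 1 - ((b - μ) / (b - l)) ^ (n - 1) := by
  have : ((b - μ) / (b - l)) ^ (n - 1) < 1 :=
    pow_lt_one₀ (div_nonneg (by linarith) (by linarith)) ((div_lt_one (by linarith)).2 (by linarith))
      (by omega)
  linarith

theorem pow_ratio_le (hlμ : l < μ) (hb : μ ≤ b) {b' : ℝ} (hbb : b ≤ b') :
    ((b - μ) / (b - l)) ^ (n - 1) ≤ ((b' - μ) / (b' - l)) ^ (n - 1) := by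
  refine pow_le_pow_left₀ (div_nonneg (by linarith) (by linarith)) ?_ _
  rw [div_le_div_iff₀ (by linarith) (by linarith)]
  nlinarith

theorem valueOf_lt_of_le (hn : 2 ≤ n) (hμu : μ < u) (hb : l ≤ b) {b' : ℝ}
    (hbb : b < b') (hb' : b' ≤ μ) : valueOf n l μ u b < valueOf n l μ u b' := by
  have hlμ : l ≤ μ := by linarith
  rw [valueOf_of_le hn (by linarith), valueOf_of_le hn hb']
  have h1 := le_lowPoint n l μ u b
  have h2 := lowPoint_le_self hn hlμ hμu.le hb
  have h4 := le_overLoss (b := b') hn hlμ hμu (by linarith) (Or.inr (by linarith))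
    (x := lowPoint n l μ u b) ⟨h1, by linarith⟩
  unfold overLoss at h4 ⊢
  set x := lowPoint n l μ u b
  have hx : 0 < u - x := by linarith
  have hm : 0 < u - μ := by linarith
  have hmono := strictMonoOn_sub_pow_add_pow (n - 1)
    (a := (u - b') / (u - x)) (b := (u - b) / (u - x))
    ⟨div_nonneg (by linarith) hx.le, (div_le_one hx).2 (by linarith)⟩
    ⟨div_nonneg (by linarith) hx.le, (div_le_one hx).2 (by linarith)⟩ (by gcongr)
  simp only at hmono
  -- With the low point x frozen and t = (u - c)/(u - x), the value for bid c is u - (u - x)(t -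
  -- t^(n-1)(1 - t)), so `hmono` applies; reoptimizing x at b' only raises the right side.
  have e : ∀ c, ((u - μ) / (u - x)) ^ (n - 1) * (c - x) * ((u - c) / (u - μ)) ^ (n - 1)
      = (u - x) * (((u - c) / (u - x)) ^ (n - 1) * (1 - (u - c) / (u - x))) := by
    intro c
    have : 1 - (u - c) / (u - x) = (c - x) / (u - x) := by field_simp; ring
    rw [this, div_pow, div_pow, div_pow]; field_simp
  have e' : ∀ c, c = u - (u - x) * ((u - c) / (u - x)) := by
    intro c; field_simp; ring
  have h5 := mul_le_mul_of_nonneg_right h4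
    (pow_nonneg (div_nonneg (by linarith : 0 ≤ u - b') hm.le) (n - 1))
  rw [e] at h5 ⊢
  have h6 := mul_lt_mul_of_pos_left hmono hx
  have := e' b
  have := e' b'
  linarith

theorem valueOf_lt_of_ge (hn : 2 ≤ n) (hlμ : l < μ) (hμu : μ < u) (hb : μ ≤ b) {b' : ℝ}
    (hbb : b < b') (hb' : b' ≤ u) : valueOf n l μ u b < valueOf n l μ u b' := by
  rw [valueOf_of_ge hμu hb, valueOf_of_ge hμu (by linarith)]
  refine add_lt_add_of_lt_of_le hbb ?_
  refine div_le_div₀ (overLoss_nonneg hn hlμ.le hμu (by linarith))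
    (overLoss_lt hn hlμ.le hμu (by linarith) hbb (Or.inr hb')).le
    (one_sub_pow_pos hn hlμ (by linarith)) ?_
  have := pow_ratio_le (n := n) hlμ hb hbb.le
  linarith

theorem strictMonoOn_valueOf (hn : 2 ≤ n) (hlμ : l < μ) (hμu : μ < u) :
    StrictMonoOn (valueOf n l μ u) (Icc l u) := by
  intro b hb b' hb' hbb
  rcases le_total b' μ with h | h
  · exact valueOf_lt_of_le hn hμu hb.1 hbb h
  · rcases le_total μ b with h' | h'
    · exact valueOf_lt_of_ge hn hlμ hμu h' hbb hb'.2
    · rcases h'.lt_or_eq with h'' | rfl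
      · refine (valueOf_lt_of_le hn hμu hb.1 h'' le_rfl).trans_le ?_
        rcases h.lt_or_eq with h3 | rfl
        · exact (valueOf_lt_of_ge hn hlμ hμu le_rfl h3 hb'.2).le
        · exact le_rfl
      · exact valueOf_lt_of_ge hn hlμ hμu le_rfl hbb hb'.2

theorem valueOf_lower (hn : 2 ≤ n) (hlμ : l ≤ μ) (hμu : μ < u) : valueOf n l μ u l = l := by
  simp [valueOf, overLoss_lower hn hlμ hμu]

theorem le_valueOf (hn : 2 ≤ n) (hlμ : l < μ) (hμu : μ < u) (hb : b ∈ Icc l u) :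
    b ≤ valueOf n l μ u b := by
  have h := overLoss_nonneg (b := b) hn hlμ.le hμu hb.1
  rcases le_total b μ with h' | h'
  · rw [valueOf_of_le hn h']
    have := mul_nonneg h (pow_nonneg
      (div_nonneg (sub_nonneg.2 hb.2) (sub_nonneg.2 hμu.le)) (n - 1))
    linarith
  · rw [valueOf_of_ge hμu h']
    have := div_nonneg h (one_sub_pow_pos hn hlμ h').le
    linarith

/-- Joint continuity, including in the beliefs μ and u, because the fixed-point argument moves them.
-/
theorem continuousAt_valueOf (hn : 2 ≤ n) (hlμ : l < μ) (hμu : μ < u) (b : ℝ) :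
    ContinuousAt (fun p : ℝ × ℝ × ℝ => valueOf n l p.1 p.2.1 p.2.2) (μ, u, b) := by
  have hL : Continuous fun p : ℝ × ℝ × ℝ => lowPoint n l p.1 p.2.1 p.2.2 := by
    unfold lowPoint xTilde
    split_ifs
    · fun_prop
    · simp only [div_eq_mul_inv]
      fun_prop
  have h3 : lowPoint n l μ u b ≤ μ := lowPoint_le_mean hlμ.le
  have h4 := one_sub_pow_pos (b := max b μ) hn hlμ (le_max_right _ _)
  have h5 := le_max_right b μ
  unfold valueOf overLoss
  refine continuousAt_snd.snd.add (ContinuousAt.div (ContinuousAt.mul (ContinuousAt.mul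
    (ContinuousAt.pow (ContinuousAt.div (by fun_prop) (by fun_prop) ?_) _) (by fun_prop))
    (ContinuousAt.pow (ContinuousAt.div (by fun_prop) (by fun_prop) ?_) _))
    (continuousAt_const.sub
      (ContinuousAt.pow (ContinuousAt.div (by fun_prop) (by fun_prop) ?_) _)) h4.ne')
  · simp only; linarith
  · simp only; linarith
  · simp only; linarith

theorem continuous_valueOf (hn : 2 ≤ n) (hlμ : l < μ) (hμu : μ < u) :
    Continuous (valueOf n l μ u) := by
  rw [continuous_iff_continuousAt]
  intro b
  exact (continuousAt_valueOf hn hlμ hμu b).comp (f := fun b => (μ, u, b)) (by fun_prop)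

theorem exists_valueOf_eq (hn : 2 ≤ n) (hlμ : l < μ) (hμu : μ < u) {v : ℝ}
    (hv : v ∈ Icc l (valueOf n l μ u u)) : ∃ b ∈ Icc l u, valueOf n l μ u b = v := by
  have h := intermediate_value_Icc (by linarith : l ≤ u) (continuous_valueOf hn hlμ hμu).continuousOn
  rw [valueOf_lower hn hlμ.le hμu] at h
  exact h hv

theorem valueOf_eq_iff_of_le (hn : 2 ≤ n) (hμu : μ < u) (hb : b ≤ μ) {v : ℝ} :
    valueOf n l μ u b = v ↔
      overLoss n l μ u b = ((u - μ) / (u - b)) ^ (n - 1) * (v - b) := by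
  rw [valueOf_of_le hn hb]
  have h1 : 0 < u - μ := by linarith
  have h2 : 0 < u - b := by linarith
  rw [div_pow, div_pow]
  generalize overLoss n l μ u b = x
  constructor
  · rintro rfl; field_simp; ring
  · rintro rfl; field_simp; ring

theorem valueOf_eq_iff_of_ge (hn : 2 ≤ n) (hlμ : l < μ) (hμu : μ < u) (hb : μ ≤ b) {v : ℝ} :
    valueOf n l μ u b = v ↔
      overLoss n l μ u b = (v - b) * (1 - ((b - μ) / (b - l)) ^ (n - 1)) := by
  rw [valueOf_of_ge hμu hb, ← div_eq_iff (one_sub_pow_pos hn hlμ hb).ne', ← eq_sub_iff_add_eq']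

/-- For n = 2 the equation `valueOf b = v` is quadratic in b on each side of μ, and the two cutoffs
are the values whose bids are μ and u. Each radicand becomes a perfect square once v is expressed
through b. -/
theorem betaTwo_spec (hlμ : l < μ) (hμu : μ < u) (hb : b ∈ Icc l u) :
    betaTwo l μ u (valueOf 2 l μ u b) = b := by
  have hmono := strictMonoOn_valueOf (n := 2) le_rfl hlμ hμu
  have hm : μ ∈ Icc l u := ⟨hlμ.le, hμu.le⟩
  have hu : u ∈ Icc l u := ⟨by linarith, le_rfl⟩
  have hO : ∀ c, overLoss 2 l μ u c = (u - μ) / (u - l) * (c - l) := by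
    intro c; simp [overLoss, lowPoint]
  have q1 : 0 < u - l := by linarith
  have q2 : 0 < u - μ := by linarith
  have q3 : 0 < μ - l := by linarith
  have e1 : (u * (μ - l) + μ * (u - μ)) / (u - l) = valueOf 2 l μ u μ := by
    rw [valueOf_of_le le_rfl le_rfl, hO]
    simp only [Nat.add_one_sub_one, pow_one]
    field_simp; ring
  have e2 : (u * (u - l) - l * (u - μ)) / (μ - l) = valueOf 2 l μ u u := by
    rw [valueOf_of_ge hμu hμu.le, hO]
    have : 1 - (u - μ) / (u - l) = (μ - l) / (u - l) := by field_simp; ring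
    simp only [Nat.add_one_sub_one, pow_one, this]
    field_simp; ring
  unfold betaTwo
  rw [e1, e2]
  split_ifs with c1 c2
  · have hbm := (hmono.lt_iff_lt hb hm).1 c1
    have : (u - l) * (u - valueOf 2 l μ u b) = (u - b) ^ 2 := by
      rw [valueOf_of_le le_rfl hbm.le, hO]
      simp only [Nat.add_one_sub_one, pow_one]
      field_simp; ring
    rw [this, Real.sqrt_sq (by linarith [hb.2])]; ring
  · have hbm := (hmono.le_iff_le hm hb).1 (not_lt.1 c1)
    have q4 : 0 < b - l := by linarith
    have hv : (valueOf 2 l μ u b - b) * (μ - l) * (u - l) = (u - μ) * (b - l) ^ 2 := by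
      rw [valueOf_of_ge hμu hbm, hO]
      have : 1 - (b - μ) / (b - l) = (μ - l) / (b - l) := by field_simp; ring
      simp only [Nat.add_one_sub_one, pow_one, this]
      field_simp; ring
    have : (μ - l) * (u - l) * ((4 * valueOf 2 l μ u b - 3 * l) * (u - μ) + u * (μ - l)
        - l * (u - l)) = (2 * (b - l) * (u - μ) + (μ - l) * (u - l)) ^ 2 := by
      linear_combination 4 * (u - μ) * hv
    rw [this, Real.sqrt_sq (by positivity)]
    field_simp; ring
  · exact le_antisymm ((hmono.le_iff_le hu hb).1 (not_lt.1 c2)) hb.2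

/-- On the relevant range of values, `betaIND` is the inverse function of `valueOf`. -/
theorem betaIND_spec (hn : 2 ≤ n) (hlμ : l < μ) (hμu : μ < u) {v : ℝ}
    (hv : v ∈ Icc l (valueOf n l μ u u)) :
    betaIND n l μ u v ∈ Icc l u ∧ valueOf n l μ u (betaIND n l μ u v) = v := by
  obtain ⟨b₀, hb₀, rfl⟩ := exists_valueOf_eq hn hlμ hμu hv
  have hmono := strictMonoOn_valueOf hn hlμ hμu
  have hm : μ ∈ Icc l u := ⟨hlμ.le, hμu.le⟩
  unfold betaIND
  split_ifs with h2
  · subst h2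
    rw [betaTwo_spec hlμ hμu hb₀]
    exact ⟨hb₀, rfl⟩
  have hO : ∀ b, lossHigh n l μ u b = overLoss n l μ u b := by
    intro b; simp [lossHigh, overLoss, lowPoint, h2]
  have hcut : cutoff n l μ u = valueOf n l μ u μ := by
    rw [valueOf_of_le hn le_rfl, div_self (by linarith), one_pow, mul_one, ← hO]
    simp [cutoff, lossHigh, mul_comm]
  set v := valueOf n l μ u b₀ with hv0
  unfold bidSolution
  rw [hcut]
  simp only [hO]
  split_ifs with c
  · have hbm := (hmono.le_iff_le hb₀ hm).1 c
    have ex : ∃ b, b ∈ Icc l μ ∧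
        overLoss n l μ u b = ((u - μ) / (u - b)) ^ (n - 1) * (v - b) :=
      ⟨b₀, ⟨hb₀.1, hbm⟩, (valueOf_eq_iff_of_le hn hμu hbm).1 rfl⟩
    obtain ⟨k1, k2⟩ := Classical.epsilon_spec ex
    set b := Classical.epsilon fun b => b ∈ Icc l μ ∧
        overLoss n l μ u b = ((u - μ) / (u - b)) ^ (n - 1) * (v - b)
    rw [min_eq_left (k1.2.trans hμu.le)]
    exact ⟨⟨k1.1, k1.2.trans hμu.le⟩, (valueOf_eq_iff_of_le hn hμu k1.2).2 k2⟩
  · have hbm := ((hmono.lt_iff_lt hm hb₀).1 (not_le.1 c)).le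
    have h0 := (valueOf_eq_iff_of_ge hn hlμ hμu hbm).1 hv0.symm
    have hbv : b₀ ≤ v := le_valueOf hn hlμ hμu hb₀
    have ex : ∃ b, b ∈ Icc μ v ∧
        overLoss n l μ u b = (v - b) * (1 - ((b - μ) / (b - l)) ^ (n - 1)) :=
      ⟨b₀, ⟨hbm, hbv⟩, h0⟩
    obtain ⟨k1, k2⟩ := Classical.epsilon_spec ex
    set b := Classical.epsilon fun b => b ∈ Icc μ v ∧
        overLoss n l μ u b = (v - b) * (1 - ((b - μ) / (b - l)) ^ (n - 1))
    -- The chosen root is only known to lie in [μ, v]. Since n ≥ 3, `overLoss` keeps increasing past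
    -- u while the right side does not increase, so no root exceeds b₀.
    have hbu : b ≤ u := by
      refine le_trans ?_ hb₀.2
      by_contra! hlt
      have g1 := overLoss_lt hn hlμ.le hμu hb₀.1 hlt (Or.inl h2)
      rw [h0, k2] at g1
      have g2 := pow_ratio_le (n := n) hlμ hbm hlt.le
      have g3 := one_sub_pow_pos hn hlμ k1.1
      have g4 : (v - b) * (1 - ((b - μ) / (b - l)) ^ (n - 1))
          ≤ (v - b₀) * (1 - ((b₀ - μ) / (b₀ - l)) ^ (n - 1)) :=
        mul_le_mul (by linarith) (by linarith) g3.le (by linarith)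
      linarith
    rw [min_eq_left hbu]
    exact ⟨⟨hlμ.le.trans k1.1, hbu⟩, (valueOf_eq_iff_of_ge hn hlμ hμu k1.1).2 k2⟩

theorem valueOf_betaIND_unique (hn : 2 ≤ n) (hlμ : l < μ) (hμu : μ < u) {v : ℝ}
    (hv : v ∈ Icc l (valueOf n l μ u u)) (hb : b ∈ Icc l u) (h : valueOf n l μ u b = v) :
    betaIND n l μ u v = b := by
  obtain ⟨h1, h2⟩ := betaIND_spec hn hlμ hμu hv
  exact (strictMonoOn_valueOf hn hlμ hμu).injOn h1 hb (h2.trans h.symm)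

theorem strictMonoOn_betaIND (hn : 2 ≤ n) (hlμ : l < μ) (hμu : μ < u) :
    StrictMonoOn (betaIND n l μ u) (Icc l (valueOf n l μ u u)) := by
  intro v hv v' hv' hlt
  obtain ⟨h1, h2⟩ := betaIND_spec hn hlμ hμu hv
  obtain ⟨h1', h2'⟩ := betaIND_spec hn hlμ hμu hv'
  rw [← (strictMonoOn_valueOf hn hlμ hμu).lt_iff_lt h1 h1', h2, h2']
  exact hlt

end

/-! ### Payoffs and expected utility: ties sandwiched between strict and weak wins -/

section

variable {n : ℕ} {i : Fin n} {v x : ℝ}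

theorem profile_self (i : Fin n) (x : ℝ) (b : {j : Fin n // j ≠ i} → ℝ) : profile i x b i = x := by
  simp [profile]

theorem profile_coe (x : ℝ) (b : {j : Fin n // j ≠ i} → ℝ) (j : {j : Fin n // j ≠ i}) :
    profile i x b j = b j := by
  simp [profile, j.2]

theorem forall_profile_le_iff (b : {j : Fin n // j ≠ i} → ℝ) :
    (∀ j, profile i x b j ≤ profile i x b i) ↔ b ∈ univ.pi fun _ => Iic x := by
  simp only [profile_self, mem_univ_pi, mem_Iic]
  refine ⟨fun h j => by simpa [profile_coe] using h j, fun h j => ?_⟩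
  by_cases hj : j = i
  · rw [hj, profile_self]
  · exact (profile_coe x b ⟨j, hj⟩).le.trans (h ⟨j, hj⟩)

open Classical in
theorem payoff_profile (b : {j : Fin n // j ≠ i} → ℝ) :
    payoff i v (profile i x b) = if b ∈ univ.pi fun _ => Iic x then
      (v - x) / ((Finset.univ.filter fun j => profile i x b j = x).card : ℝ) else 0 := by
  unfold payoff
  by_cases h : b ∈ univ.pi fun _ => Iic x
  · rw [if_pos h, if_pos ((forall_profile_le_iff b).2 h), profile_self]
  · rw [if_neg h, if_neg (mt (forall_profile_le_iff b).1 h)]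

open Classical in
theorem one_le_card_ties (b : {j : Fin n // j ≠ i} → ℝ) :
    (1 : ℝ) ≤ ((Finset.univ.filter fun j => profile i x b j = x).card : ℝ) := by
  exact_mod_cast Finset.card_pos.2 ⟨i, by simp [profile_self]⟩

theorem payoff_of_forall_lt {b : {j : Fin n // j ≠ i} → ℝ} (hb : b ∈ univ.pi fun _ => Iio x) :
    payoff i v (profile i x b) = v - x := by
  classical
  have h' : b ∈ univ.pi fun _ => Iic x := fun j hj => mem_Iic.2 (hb j hj).le
  rw [payoff_profile, if_pos h']
  have : (Finset.univ.filter fun j => profile i x b j = x) = {i} := by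
    ext j
    simp only [Finset.mem_filter, Finset.mem_univ, true_and, Finset.mem_singleton]
    constructor
    · intro h
      by_contra hj
      have h1 := hb ⟨j, hj⟩ (mem_univ _)
      rw [← profile_coe x b ⟨j, hj⟩] at h1
      exact h1.ne h
    · rintro rfl
      exact profile_self j x b
  rw [this]
  simp

theorem payoff_nonneg (h : x ≤ v) (b : {j : Fin n // j ≠ i} → ℝ) :
    0 ≤ payoff i v (profile i x b) := by
  classical
  rw [payoff_profile]
  split_ifs
  · exact div_nonneg (sub_nonneg.2 h) (Nat.cast_nonneg _)
  · exact le_rfl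

theorem payoff_nonpos (h : v ≤ x) (b : {j : Fin n // j ≠ i} → ℝ) :
    payoff i v (profile i x b) ≤ 0 := by
  classical
  rw [payoff_profile]
  split_ifs
  · exact div_nonpos_of_nonpos_of_nonneg (sub_nonpos.2 h) (Nat.cast_nonneg _)
  · exact le_rfl

theorem payoff_le_indicator (h : x ≤ v) (b : {j : Fin n // j ≠ i} → ℝ) :
    payoff i v (profile i x b) ≤ (univ.pi fun _ => Iic x).indicator (fun _ => v - x) b := by
  classical
  rw [payoff_profile, indicator_apply]
  split_ifs
  · exact div_le_self (sub_nonneg.2 h) (one_le_card_ties b)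
  · exact le_rfl

theorem indicator_le_payoff (h : x ≤ v) (b : {j : Fin n // j ≠ i} → ℝ) :
    (univ.pi fun _ => Iio x).indicator (fun _ => v - x) b ≤ payoff i v (profile i x b) := by
  by_cases hb : b ∈ univ.pi fun _ => Iio x
  · rw [indicator_of_mem hb, payoff_of_forall_lt hb]
  · rw [indicator_of_notMem hb]
    exact payoff_nonneg h b

/-- When winning is costly, sharing a tie softens the cost, so the upper bound counts strict wins
only. -/
theorem payoff_le_indicator_of_ge (h : v ≤ x) (b : {j : Fin n // j ≠ i} → ℝ) :
    payoff i v (profile i x b) ≤ (univ.pi fun _ => Iio x).indicator (fun _ => v - x) b := by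
  by_cases hb : b ∈ univ.pi fun _ => Iio x
  · rw [indicator_of_mem hb, payoff_of_forall_lt hb]
  · rw [indicator_of_notMem hb]
    exact payoff_nonpos h b

theorem abs_payoff_le (b : {j : Fin n // j ≠ i} → ℝ) :
    ‖payoff i v (profile i x b)‖ ≤ |v - x| := by
  classical
  rw [payoff_profile, Real.norm_eq_abs]
  split_ifs
  · rw [abs_div, Nat.abs_cast]
    exact div_le_self (abs_nonneg _) (one_le_card_ties b)
  · simp

theorem measurable_payoff (i : Fin n) (v x : ℝ) :
    Measurable fun b : {j : Fin n // j ≠ i} → ℝ => payoff i v (profile i x b) := by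
  classical
  simp only [payoff_profile]
  refine Measurable.ite (MeasurableSet.univ_pi fun _ => measurableSet_Iic) ?_ measurable_const
  refine measurable_const.div ?_
  -- Writing the number of ties as a sum of indicators makes its measurability visible.
  have : (fun b : {j : Fin n // j ≠ i} → ℝ =>
      ((Finset.univ.filter fun j => profile i x b j = x).card : ℝ))
      = fun b => ∑ j, if profile i x b j = x then (1 : ℝ) else 0 := by
    funext b
    simp
  rw [this]
  refine Finset.measurable_fun_sum _ fun j _ => ?_
  have hm : Measurable fun b : {j : Fin n // j ≠ i} → ℝ => profile i x b j := by
    unfold profile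
    split_ifs with h
    · exact measurable_const
    · exact measurable_pi_apply _
  exact Measurable.ite (hm (measurableSet_singleton x)) measurable_const measurable_const

variable {P : Measure ({j : Fin n // j ≠ i} → ℝ)}

theorem expectedUtility_nonneg (h : x ≤ v) : 0 ≤ expectedUtility i v x P :=
  integral_nonneg (payoff_nonneg h)

theorem expectedUtility_nonpos (h : v ≤ x) : expectedUtility i v x P ≤ 0 :=
  integral_nonpos (payoff_nonpos h)

theorem integral_indicator_pi (s : Set ℝ) (hs : MeasurableSet s) (c : ℝ) :
    ∫ b, (univ.pi fun _ => s).indicator (fun _ => c) b ∂P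
      = c * P.real (univ.pi fun _ : {j : Fin n // j ≠ i} => s) := by
  rw [integral_indicator_const _ (MeasurableSet.univ_pi fun _ => hs), smul_eq_mul, mul_comm]

variable [IsProbabilityMeasure P]

theorem integrable_payoff : Integrable (fun b => payoff i v (profile i x b)) P :=
  Integrable.of_bound (measurable_payoff i v x).aestronglyMeasurable _
    (Filter.Eventually.of_forall abs_payoff_le)

theorem integrable_indicator_pi (s : Set ℝ) (hs : MeasurableSet s) (c : ℝ) :
    Integrable ((univ.pi fun _ : {j : Fin n // j ≠ i} => s).indicator fun _ => c) P :=
  (integrable_const c).indicator (MeasurableSet.univ_pi fun _ => hs)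

theorem expectedUtility_le (h : x ≤ v) :
    expectedUtility i v x P ≤ (v - x) * P.real (univ.pi fun _ => Iic x) := by
  rw [← integral_indicator_pi _ measurableSet_Iic]
  exact integral_mono integrable_payoff (integrable_indicator_pi _ measurableSet_Iic _)
    (payoff_le_indicator h)

theorem le_expectedUtility (h : x ≤ v) :
    (v - x) * P.real (univ.pi fun _ => Iio x) ≤ expectedUtility i v x P := by
  rw [← integral_indicator_pi _ measurableSet_Iio]
  exact integral_mono (integrable_indicator_pi _ measurableSet_Iio _) integrable_payoff
    (indicator_le_payoff h)

theorem expectedUtility_le_of_ge (h : v ≤ x) :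
    expectedUtility i v x P ≤ (v - x) * P.real (univ.pi fun _ => Iio x) := by
  rw [← integral_indicator_pi _ measurableSet_Iio]
  exact integral_mono integrable_payoff (integrable_indicator_pi _ measurableSet_Iio _)
    (payoff_le_indicator_of_ge h)

/-- Bidding slightly above `x` secures the utility of winning all ties at `x`. -/
theorem le_iSup_expectedUtility (hv : 0 ≤ v) (hx : 0 ≤ x) :
    (((v - x) * P.real (univ.pi fun _ => Iic x) : ℝ) : EReal)
      ≤ ⨆ b' ∈ Ici (0 : ℝ), (expectedUtility i v b' P : EReal) := by
  have hsup : ∀ y, 0 ≤ y → (expectedUtility i v y P : EReal)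
      ≤ ⨆ b' ∈ Ici (0 : ℝ), (expectedUtility i v b' P : EReal) := fun y hy =>
    le_iSup₂ (f := fun b' (_ : b' ∈ Ici (0 : ℝ)) => (expectedUtility i v b' P : EReal)) y hy
  rcases le_or_gt v x with h | h
  · refine le_trans ?_ (hsup v hv)
    exact EReal.coe_le_coe_iff.2 ((mul_nonpos_of_nonpos_of_nonneg (by linarith)
      measureReal_nonneg).trans (expectedUtility_nonneg le_rfl))
  · have ht : Filter.Tendsto (fun y => (((v - y) * P.real (univ.pi fun _ => Iic x) : ℝ) : EReal))
        (nhdsWithin x (Ioi x)) (nhds (((v - x) * P.real (univ.pi fun _ => Iic x) : ℝ) : EReal)) := by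
      have : Continuous fun y => (((v - y) * P.real (univ.pi fun _ => Iic x) : ℝ) : EReal) :=
        continuous_coe_real_ereal.comp (by fun_prop)
      exact this.continuousAt.mono_left nhdsWithin_le_nhds
    refine le_of_tendsto ht ?_
    filter_upwards [Ioo_mem_nhdsGT h] with y hy
    refine le_trans (EReal.coe_le_coe_iff.2 ?_) (hsup y (hx.trans hy.1.le))
    refine le_trans ?_ (le_expectedUtility hy.2.le)
    refine mul_le_mul_of_nonneg_left (measureReal_mono fun b hb j hj => ?_) (by linarith [hy.2])
    exact (hb j hj).trans_lt hy.1

end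

/-! ### Belief sets: Markov bounds and two-point beliefs -/

section

variable {n : ℕ} {i : Fin n} {l μ u v : ℝ}

theorem isProbabilityMeasure_of_mem_beliefSet {P : Measure ({j : Fin n // j ≠ i} → ℝ)}
    (hP : P ∈ beliefSet i l μ u) : IsProbabilityMeasure P := by
  obtain ⟨B, hB, rfl⟩ := hP
  have := fun j => (hB j).1
  infer_instance

theorem maxLoss_le {b c : ℝ}
    (h : ∀ P ∈ beliefSet i l μ u, ∀ b', 0 ≤ b' →
      expectedUtility i v b' P ≤ c + expectedUtility i v b P) :
    maxLoss i l μ u v b ≤ (c : EReal) := by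
  refine iSup₂_le fun P hP => ?_
  unfold loss
  rw [EReal.sub_le_iff_le_add (by simp) (by simp)]
  refine iSup₂_le fun b' hb' => ?_
  exact_mod_cast h P hP b' hb'

/-- The comparison bid x may be credited with all ties at x, since bids slightly above x approach
that utility. -/
theorem le_maxLoss {P : Measure ({j : Fin n // j ≠ i} → ℝ)} (hP : P ∈ beliefSet i l μ u)
    (hv : 0 ≤ v) {x b c : ℝ} (hx : 0 ≤ x)
    (h : c + expectedUtility i v b P ≤ (v - x) * P.real (univ.pi fun _ => Iic x)) :
    (c : EReal) ≤ maxLoss i l μ u v b := by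
  have := isProbabilityMeasure_of_mem_beliefSet hP
  refine le_trans ?_ (le_iSup₂ (f := fun P (_ : P ∈ beliefSet i l μ u) => loss i v b P) P hP)
  unfold loss
  rw [EReal.le_sub_iff_add_le (by simp) (by simp)]
  refine le_trans ?_ (le_iSup_expectedUtility hv hx)
  exact_mod_cast h

theorem pi_real_univ_pi (B : {j : Fin n // j ≠ i} → Measure ℝ) [∀ j, IsProbabilityMeasure (B j)]
    (s : Set ℝ) : (Measure.pi B).real (univ.pi fun _ => s) = ∏ j, (B j).real s := by
  simp [Measure.real, Measure.pi_pi, ENNReal.toReal_prod]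

theorem card_opponents (i : Fin n) : Fintype.card {j : Fin n // j ≠ i} = n - 1 := by
  simp

theorem prod_real_le_pow (B : {j : Fin n // j ≠ i} → Measure ℝ) {s : Set ℝ} {c : ℝ}
    (h : ∀ j, (B j).real s ≤ c) : ∏ j, (B j).real s ≤ c ^ (n - 1) := by
  refine (Finset.prod_le_prod (fun _ _ => measureReal_nonneg) fun j _ => h j).trans_eq ?_
  rw [Finset.prod_const, Finset.card_univ, card_opponents]

theorem pow_le_prod_real (B : {j : Fin n // j ≠ i} → Measure ℝ) {s : Set ℝ} {c : ℝ} (hc : 0 ≤ c)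
    (h : ∀ j, c ≤ (B j).real s) : c ^ (n - 1) ≤ ∏ j, (B j).real s := by
  refine Eq.trans_le ?_ (Finset.prod_le_prod (fun _ _ => hc) fun j _ => h j)
  rw [Finset.prod_const, Finset.card_univ, card_opponents]

section Single

variable {B : Measure ℝ}

theorem ae_mem_Icc_of_mem_singleBeliefSet (hB : B ∈ singleBeliefSet l μ u) :
    ∀ᵐ x ∂B, x ∈ Icc l u := by
  have := hB.1
  exact (prob_compl_eq_zero_iff measurableSet_Icc).2 hB.2.1

theorem integrable_id_of_mem_singleBeliefSet (hB : B ∈ singleBeliefSet l μ u) :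
    Integrable (fun x => x) B := by
  have := hB.1
  exact Integrable.of_mem_Icc l u aemeasurable_id (ae_mem_Icc_of_mem_singleBeliefSet hB)

/-- Markov's inequality for u - y, which is nonnegative with mean u - μ. -/
theorem real_Iic_le (hB : B ∈ singleBeliefSet l μ u) {x : ℝ} (hx : x < u) :
    B.real (Iic x) ≤ (u - μ) / (u - x) := by
  have := hB.1
  rw [le_div_iff₀ (by linarith)]
  have hi := integrable_id_of_mem_singleBeliefSet hB
  have e : ∫ y, (u - y) ∂B = u - μ := by
    rw [integral_sub (integrable_const u) hi, hB.2.2]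
    simp
  rw [← e, ← smul_eq_mul, ← integral_indicator_const _ measurableSet_Iic]
  refine integral_mono_ae ((integrable_const _).indicator measurableSet_Iic)
    ((integrable_const u).sub hi) ?_
  filter_upwards [ae_mem_Icc_of_mem_singleBeliefSet hB] with y hy
  by_cases h : y ∈ Iic x
  · rw [indicator_of_mem h]
    simp only [mem_Iic] at h
    linarith
  · rw [indicator_of_notMem h]
    linarith [hy.2]

/-- Integrate b - y ≤ (b - l)·1{y < b}, valid since y ≥ l. -/
theorem le_real_Iio (hB : B ∈ singleBeliefSet l μ u) {b : ℝ} (hb : l < b) :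
    (b - μ) / (b - l) ≤ B.real (Iio b) := by
  have := hB.1
  rw [div_le_iff₀ (by linarith)]
  have hi := integrable_id_of_mem_singleBeliefSet hB
  have e : ∫ y, (b - y) ∂B = b - μ := by
    rw [integral_sub (integrable_const b) hi, hB.2.2]
    simp
  rw [← e, ← smul_eq_mul, ← integral_indicator_const _ measurableSet_Iio]
  refine integral_mono_ae ((integrable_const b).sub hi)
    ((integrable_const _).indicator measurableSet_Iio) ?_
  filter_upwards [ae_mem_Icc_of_mem_singleBeliefSet hB] with y hy
  by_cases h : y ∈ Iio b
  · rw [indicator_of_mem h]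
    linarith [hy.1]
  · rw [indicator_of_notMem h]
    simp only [mem_Iio, not_lt] at h
    linarith

theorem real_Iic_eq_zero (hB : B ∈ singleBeliefSet l μ u) {x : ℝ} (hx : x < l) :
    B.real (Iic x) = 0 := by
  have h := ae_mem_Icc_of_mem_singleBeliefSet hB
  rw [Measure.real, measure_eq_zero_iff_ae_notMem.2, ENNReal.toReal_zero]
  filter_upwards [h] with y hy h'
  exact absurd (hy.1.trans h') (by linarith)

end Single

/-- The distribution with mass `q` at `x` and mass `1 - q` at `y`. -/
noncomputable def twoPoint (q x y : ℝ) : Measure ℝ :=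
  ENNReal.ofReal q • Measure.dirac x + ENNReal.ofReal (1 - q) • Measure.dirac y

theorem isProbabilityMeasure_twoPoint {q : ℝ} (hq : q ∈ Icc (0 : ℝ) 1) (x y : ℝ) :
    IsProbabilityMeasure (twoPoint q x y) := by
  refine ⟨?_⟩
  simp only [twoPoint, Measure.coe_add, Measure.coe_smul, Pi.add_apply, Pi.smul_apply,
    measure_univ, smul_eq_mul, mul_one]
  rw [← ENNReal.ofReal_add hq.1 (by linarith [hq.2])]
  simp

theorem twoPoint_mem {q x y : ℝ} (hq : q ∈ Icc (0 : ℝ) 1) (hx : x ∈ Icc l u) (hy : y ∈ Icc l u)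
    (hmean : q * x + (1 - q) * y = μ) : twoPoint q x y ∈ singleBeliefSet l μ u := by
  have hp := isProbabilityMeasure_twoPoint hq x y
  refine ⟨hp, ?_, ?_⟩
  · rw [← hp.measure_univ]
    simp [twoPoint, Measure.dirac_apply' _ measurableSet_Icc, hx.1, hx.2, hy.1, hy.2]
  · unfold twoPoint
    rw [integral_add_measure ((integrable_dirac (by simp)).smul_measure ENNReal.ofReal_ne_top)
      ((integrable_dirac (by simp)).smul_measure ENNReal.ofReal_ne_top), integral_smul_measure,
      integral_smul_measure, integral_dirac, integral_dirac, ENNReal.toReal_ofReal hq.1,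
      ENNReal.toReal_ofReal (by linarith [hq.2])]
    simpa using hmean

theorem twoPoint_real {q x y : ℝ} (hq : q ∈ Icc (0 : ℝ) 1) {s : Set ℝ} (hs : MeasurableSet s) :
    (twoPoint q x y).real s = q * s.indicator 1 x + (1 - q) * s.indicator 1 y := by
  have h1 : 0 ≤ 1 - q := by linarith [hq.2]
  have hd : ∀ z : ℝ, (Measure.dirac z).real s = s.indicator 1 z := by
    intro z
    rw [Measure.real, Measure.dirac_apply' _ hs]
    by_cases h : z ∈ s <;> simp [h]
  have f1 : (ENNReal.ofReal q • Measure.dirac x) s ≠ ⊤ :=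
    ENNReal.mul_ne_top ENNReal.ofReal_ne_top (measure_ne_top _ _)
  have f2 : (ENNReal.ofReal (1 - q) • Measure.dirac y) s ≠ ⊤ :=
    ENNReal.mul_ne_top ENNReal.ofReal_ne_top (measure_ne_top _ _)
  unfold twoPoint
  rw [measureReal_add_apply f1 f2, measureReal_ennreal_smul_apply, measureReal_ennreal_smul_apply,
    ENNReal.toReal_ofReal hq.1, ENNReal.toReal_ofReal h1,
    hd, hd]

/-- All opponents draw from the same two-point law. Utilities are bounded through probabilities of
cubes alone, so the product measure can stay abstract. -/
theorem le_maxLoss_twoPoint (hl : 0 ≤ l) (hv : 0 ≤ v) {q x y b c : ℝ} (hq : q ∈ Icc (0 : ℝ) 1)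
    (hx : x ∈ Icc l u) (hy : y ∈ Icc l u) (hmean : q * x + (1 - q) * y = μ) {z : ℝ} (hz : l ≤ z)
    (h : ∀ P : Measure ({j : Fin n // j ≠ i} → ℝ), IsProbabilityMeasure P →
      (∀ s, MeasurableSet s → P.real (univ.pi fun _ => s)
        = (q * s.indicator 1 x + (1 - q) * s.indicator 1 y) ^ (n - 1)) →
      c + expectedUtility i v b P ≤ (v - z) * P.real (univ.pi fun _ => Iic z)) :
    (c : EReal) ≤ maxLoss i l μ u v b := by
  have hp := isProbabilityMeasure_twoPoint hq x y
  refine le_maxLoss (P := Measure.pi fun _ => twoPoint q x y)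
    ⟨fun _ => twoPoint q x y, fun _ => twoPoint_mem hq hx hy hmean, rfl⟩ hv (hl.trans hz)
    (h _ inferInstance fun s hs => ?_)
  rw [pi_real_univ_pi, Finset.prod_const, Finset.card_univ, card_opponents, twoPoint_real hq hs]

end

/-! ### Minimax optimality of the bid that equates the two losses -/

section

variable {n : ℕ} {i : Fin n} {l μ u b v : ℝ}

/-- This is the first-order condition under which, in `win_le_of_valueOf`, moving the opponents' low
point up from b does not raise the gain. It follows from Bernoulli applied to (u - z)/(u - b) = 1 +
(b - z)/(u - b), with z the low point. -/
theorem mul_sub_le_sub_of_valueOf (hn : 2 ≤ n) (hlμ : l ≤ μ) (hμu : μ < u) (hlb : l ≤ b)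
    (hbμ : b ≤ μ) (hV : valueOf n l μ u b = v) : ((n : ℝ) - 1) * (v - b) ≤ u - b := by
  rw [valueOf_of_le hn hbμ] at hV
  have h2 := lowPoint_le_self hn hlμ hμu.le hlb
  unfold overLoss at hV
  set z := lowPoint n l μ u b
  have hz : 0 < u - z := by linarith
  have hb : 0 < u - b := by linarith
  have hm : 0 < u - μ := by linarith
  have e : v - b = (b - z) * ((u - b) / (u - z)) ^ (n - 1) := by
    rw [← hV, div_pow, div_pow, div_pow]; field_simp; ring
  obtain ⟨k, rfl⟩ : ∃ k, n = k + 2 := ⟨n - 2, by omega⟩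
  have e1 : k + 2 - 1 = k + 1 := rfl
  have hB := one_add_mul_le_pow (a := (b - z) / (u - b))
    (by have := div_nonneg (by linarith : 0 ≤ b - z) hb.le; linarith) (k + 1)
  have e2 : 1 + (b - z) / (u - b) = (u - z) / (u - b) := by field_simp; ring
  rw [e2, div_pow, le_div_iff₀ (by positivity)] at hB
  have e3 : (1 + ((k + 1 : ℕ) : ℝ) * ((b - z) / (u - b))) * (u - b) ^ (k + 1)
      = (u - b) ^ (k + 1) + ((k : ℝ) + 1) * (b - z) * (u - b) ^ k := by
    push_cast; field_simp; ring
  rw [e3] at hB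
  have h5 : 0 < (u - b) ^ (k + 1) := by positivity
  rw [e, e1, div_pow, mul_div_assoc', mul_div_assoc', div_le_iff₀ (by positivity)]
  push_cast
  calc ((k : ℝ) + 2 - 1) * ((b - z) * (u - b) ^ (k + 1))
      = (u - b) * (((k : ℝ) + 1) * (b - z) * (u - b) ^ k) := by ring
    _ ≤ _ := mul_le_mul_of_nonneg_left (by linarith) hb.le

/-- Below the cutoff, underbidding is worst when the opponents bid `b` or `u`. -/
theorem win_le_of_valueOf (hn : 2 ≤ n) (hlμ : l < μ) (hμu : μ < u) (hlb : l ≤ b)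
    (hbμ : b ≤ μ) (hV : valueOf n l μ u b = v) {x : ℝ} (hx : b ≤ x) (hxμ : x ≤ μ) :
    ((u - μ) / (u - x)) ^ (n - 1) * (v - x) ≤ overLoss n l μ u b := by
  rw [(valueOf_eq_iff_of_le hn hμu hbμ).1 hV]
  have h := mul_sub_le_sub_of_valueOf hn hlμ.le hμu hlb hbμ hV
  have hc : ((n - 1 : ℕ) : ℝ) = (n : ℝ) - 1 := by push_cast [Nat.cast_sub (by omega : 1 ≤ n)]; ring
  have hn' : (2 : ℝ) ≤ n := by exact_mod_cast hn
  have p1 : 0 < u - x := by linarith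
  have p2 : 0 < u - b := by linarith
  have hbv : b ≤ v := hV ▸ le_valueOf hn hlμ hμu ⟨hlb, by linarith⟩
  have hvu : v ≤ u := by nlinarith
  have key := sub_mul_pow_le (m := n - 1) (y := u - x) (y₀ := u - b) (c := u - v) p2 p1.le
    (by linarith) (by rw [hc]; nlinarith)
  rw [div_pow, div_pow, div_mul_eq_mul_div, div_mul_eq_mul_div, div_le_div_iff₀ (by positivity)
    (by positivity), mul_assoc, mul_assoc]
  refine mul_le_mul_of_nonneg_left ?_ (pow_nonneg (by linarith) _)
  simpa using key

/-- A lower deviation x gains at most b - x times the probability that x wins, since b wins whenever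
x does. For a higher deviation with b ≤ μ the utility of b is dropped altogether; with b ≥ μ it is
bounded below by `le_real_Iio`. -/
theorem expectedUtility_le_add_overLoss (hn : 2 ≤ n) (hlμ : l < μ) (hμu : μ < u)
    (hb : b ∈ Icc l u) (hV : valueOf n l μ u b = v)
    {P : Measure ({j : Fin n // j ≠ i} → ℝ)} (hP : P ∈ beliefSet i l μ u) (x : ℝ) :
    expectedUtility i v x P ≤ overLoss n l μ u b + expectedUtility i v b P := by
  have hprob := isProbabilityMeasure_of_mem_beliefSet hP
  have hbv : b ≤ v := hV ▸ le_valueOf hn hlμ hμu hb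
  have hO := overLoss_nonneg hn hlμ.le hμu hb.1
  have hUb := expectedUtility_nonneg (i := i) (P := P) hbv
  rcases le_total v x with hvx | hxv
  · have := expectedUtility_nonpos (i := i) (P := P) hvx
    linarith
  have hUx := expectedUtility_le (i := i) (P := P) hxv
  have hUb' := le_expectedUtility (i := i) (P := P) hbv
  obtain ⟨B, hB, rfl⟩ := hP
  have hBp := fun j => (hB j).1
  rcases lt_trichotomy x b with hxb | rfl | hbx
  · have hmono : (Measure.pi B).real (univ.pi fun _ => Iic x)
        ≤ (Measure.pi B).real (univ.pi fun _ => Iio b) :=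
      measureReal_mono fun c hc j hj => (hc j hj).trans_lt hxb
    suffices h : (b - x) * (Measure.pi B).real (univ.pi fun _ => Iic x) ≤ overLoss n l μ u b by
      have := mul_le_mul_of_nonneg_left hmono (by linarith : 0 ≤ v - b)
      linarith
    rcases lt_or_ge x l with hxl | hlx
    · rw [pi_real_univ_pi]
      have : ∏ j, (B j).real (Iic x) ≤ 0 ^ (n - 1) :=
        prod_real_le_pow B fun j => (real_Iic_eq_zero (hB j) hxl).le
      rw [zero_pow (by omega)] at this
      exact (mul_nonpos_of_nonneg_of_nonpos (by linarith) this).trans hO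
    · rcases le_total x μ with hxμ | hμx
      · refine le_trans ?_ (le_overLoss hn hlμ.le hμu hb.1 (Or.inr hb.2) ⟨hlx, hxμ⟩)
        rw [mul_comm]
        refine mul_le_mul_of_nonneg_right ?_ (by linarith)
        rw [pi_real_univ_pi]
        exact prod_real_le_pow B fun j => real_Iic_le (hB j) (by linarith)
      · have := le_overLoss hn hlμ.le hμu hb.1 (Or.inr hb.2) ⟨hlμ.le, le_rfl⟩
        rw [div_self (by linarith), one_pow, one_mul] at this
        have h1 : (b - x) * (Measure.pi B).real (univ.pi fun _ => Iic x) ≤ b - x :=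
          mul_le_of_le_one_right (by linarith) measureReal_le_one
        linarith
  · linarith
  · rcases le_total b μ with hbμ | hμb
    · suffices h : (v - x) * (Measure.pi B).real (univ.pi fun _ => Iic x) ≤ overLoss n l μ u b by
        linarith
      rcases le_total x μ with hxμ | hμx
      · refine le_trans ?_ (win_le_of_valueOf hn hlμ hμu hb.1 hbμ hV hbx.le hxμ)
        rw [mul_comm]
        refine mul_le_mul_of_nonneg_right ?_ (by linarith)
        rw [pi_real_univ_pi]
        exact prod_real_le_pow B fun j => real_Iic_le (hB j) (by linarith)
      · have := win_le_of_valueOf hn hlμ hμu hb.1 hbμ hV hbμ le_rfl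
        rw [div_self (by linarith), one_pow, one_mul] at this
        have h1 : (v - x) * (Measure.pi B).real (univ.pi fun _ => Iic x) ≤ v - x :=
          mul_le_of_le_one_right (by linarith) measureReal_le_one
        linarith
    · have h1 : (v - x) * (Measure.pi B).real (univ.pi fun _ => Iic x) ≤ v - x :=
        mul_le_of_le_one_right (by linarith) measureReal_le_one
      have h2 : ((b - μ) / (b - l)) ^ (n - 1) ≤ (Measure.pi B).real (univ.pi fun _ => Iio b) := by
        rw [pi_real_univ_pi]
        exact pow_le_prod_real B (div_nonneg (by linarith) (by linarith))
          fun j => le_real_Iio (hB j) (by linarith)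
      rw [(valueOf_eq_iff_of_ge hn hlμ hμu hμb).1 hV]
      have h3 := mul_le_mul_of_nonneg_left h2 (by linarith : 0 ≤ v - b)
      linarith

theorem overLoss_le_maxLoss_of_gt (hn : 2 ≤ n) (hl : 0 ≤ l) (hlμ : l < μ) (hμu : μ < u)
    (hv : 0 ≤ v) (hb : b ∈ Icc l u) {b' : ℝ} (hbb : b < b') :
    (overLoss n l μ u b : EReal) ≤ maxLoss i l μ u v b' := by
  have hm : 0 < u - μ := by linarith
  rcases lt_or_ge b' u with hbu | hub
  · have h1 := le_lowPoint n l μ u b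
    have h2 := lowPoint_le_self hn hlμ.le hμu.le hb.1
    have h3 : lowPoint n l μ u b ≤ μ := lowPoint_le_mean hlμ.le
    unfold overLoss
    set z := lowPoint n l μ u b
    have hz : 0 < u - z := by linarith
    -- Against opponents at z or u, the bids b' and z win in the same event, so z saves b' - z > b -
    -- z there.
    refine le_maxLoss_twoPoint hl hv (q := (u - μ) / (u - z)) (x := z) (y := u)
      ⟨div_nonneg hm.le hz.le, (div_le_one hz).2 (by linarith)⟩ ⟨h1, by linarith⟩
      ⟨by linarith, le_rfl⟩ (by field_simp; ring) (z := z) h1 fun P hP h => ?_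
    have e : ∀ s : Set ℝ, MeasurableSet s → z ∈ s → u ∉ s →
        P.real (univ.pi fun _ => s) = ((u - μ) / (u - z)) ^ (n - 1) := by
      intro s hs h1 h2
      simp [h s hs, h1, h2]
    rw [e _ measurableSet_Iic (mem_Iic.2 le_rfl) (by simp only [mem_Iic]; linarith)]
    have hq : 0 ≤ ((u - μ) / (u - z)) ^ (n - 1) := pow_nonneg (div_nonneg hm.le hz.le) _
    rcases le_total b' v with hbv | hvb
    · have := expectedUtility_le (i := i) (P := P) hbv
      rw [e _ measurableSet_Iic (mem_Iic.2 (by linarith)) (by simp only [mem_Iic]; linarith)] at this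
      nlinarith
    · have := expectedUtility_le_of_ge (i := i) (P := P) hvb
      rw [e _ measurableSet_Iio (mem_Iio.2 (by linarith)) (by simp only [mem_Iio]; linarith)] at this
      nlinarith
  -- For b' ≥ u, opponents who surely bid μ already cost b' - μ ≥ u - μ.
  · have hO := overLoss_le_upper hn hlμ.le hμu hb.1 hb.2
    refine le_maxLoss_twoPoint hl hv (q := 1) (x := μ) (y := u) (by simp) ⟨hlμ.le, hμu.le⟩
      ⟨by linarith, le_rfl⟩ (by ring) (z := μ) hlμ.le fun P hP h => ?_
    rw [h _ measurableSet_Iic]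
    rcases le_total b' v with hbv | hvb
    · have := expectedUtility_le (i := i) (P := P) hbv
      have h1 := mul_le_of_le_one_right (by linarith : 0 ≤ v - b')
        (measureReal_le_one (μ := P) (s := univ.pi fun _ => Iic b'))
      simp only [mem_Iic, le_refl, indicator_of_mem, Pi.one_apply, sub_self, zero_mul, add_zero,
        mul_one, one_pow]
      linarith
    · have := expectedUtility_le_of_ge (i := i) (P := P) hvb
      rw [h _ measurableSet_Iio, indicator_of_mem (mem_Iio.2 (by linarith))] at this
      simp only [mem_Iic, le_refl, indicator_of_mem, Pi.one_apply, sub_self, zero_mul, add_zero,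
        mul_one, one_pow] at this ⊢
      linarith

theorem overLoss_le_maxLoss_of_lt (hn : 2 ≤ n) (hl : 0 ≤ l) (hlμ : l < μ) (hμu : μ < u)
    (hv : 0 ≤ v) (hb : b ∈ Icc l u) (hV : valueOf n l μ u b = v) {b' : ℝ} (hbb : b' < b) :
    (overLoss n l μ u b : EReal) ≤ maxLoss i l μ u v b' := by
  have hm : 0 < u - μ := by linarith
  have hbv : b ≤ v := hV ▸ le_valueOf hn hlμ hμu hb
  rcases le_total b μ with hbμ | hμb
  · have hz : 0 < u - b := by linarith
    refine le_maxLoss_twoPoint hl hv (q := (u - μ) / (u - b)) (x := b) (y := u)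
      ⟨div_nonneg hm.le hz.le, (div_le_one hz).2 (by linarith)⟩ hb
      ⟨by linarith, le_rfl⟩ (by field_simp; ring) (z := b) hb.1 fun P hP h => ?_
    have := expectedUtility_le (i := i) (P := P) (by linarith : b' ≤ v)
    rw [h _ measurableSet_Iic, indicator_of_notMem (by simp only [mem_Iic]; linarith),
      indicator_of_notMem (by simp only [mem_Iic]; linarith), mul_zero, mul_zero, add_zero,
      zero_pow (by omega)] at this
    rw [h _ measurableSet_Iic, indicator_of_mem (mem_Iic.2 le_rfl),
      indicator_of_notMem (by simp only [mem_Iic]; linarith),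
      (valueOf_eq_iff_of_le hn hμu hbμ).1 hV]
    simp only [Pi.one_apply, mul_one, mul_zero, add_zero]
    linarith
  · rcases lt_or_ge b' μ with hb'μ | hμb'
    · refine le_maxLoss_twoPoint hl hv (q := 1) (x := μ) (y := u) (by simp) ⟨hlμ.le, hμu.le⟩
        ⟨by linarith, le_rfl⟩ (by ring) (z := μ) hlμ.le fun P hP h => ?_
      have := expectedUtility_le (i := i) (P := P) (by linarith : b' ≤ v)
      rw [h _ measurableSet_Iic, indicator_of_notMem (by simp only [mem_Iic]; linarith), mul_zero,
        sub_self, zero_mul, add_zero, zero_pow (by omega)] at this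
      rw [h _ measurableSet_Iic, indicator_of_mem (mem_Iic.2 le_rfl),
        (valueOf_eq_iff_of_ge hn hlμ hμu hμb).1 hV]
      have h1 : (v - b) * (1 - ((b - μ) / (b - l)) ^ (n - 1)) ≤ v - b := by
        refine mul_le_of_le_one_right (by linarith) ?_
        have : 0 ≤ ((b - μ) / (b - l)) ^ (n - 1) :=
          pow_nonneg (div_nonneg (by linarith) (by linarith)) _
        linarith
      simp only [Pi.one_apply, mul_one, sub_self, zero_mul, add_zero, one_pow]
      linarith
    -- f z is the loss forced by opponents mixing between l and z > b'. At z = b' itself the bid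
    -- would share ties, so the bound is obtained in the limit z ↓ b'.
    · set f : ℝ → ℝ := fun z => (v - z) - (v - b') * ((z - μ) / (z - l)) ^ (n - 1) with hf
      have hfc : ContinuousAt f b' := by
        refine ContinuousAt.sub (by fun_prop) (ContinuousAt.mul continuousAt_const
          (ContinuousAt.pow (ContinuousAt.div (by fun_prop) (by fun_prop) ?_) _))
        linarith
      have hle : overLoss n l μ u b ≤ f b' := by
        rw [(valueOf_eq_iff_of_ge hn hlμ hμu hμb).1 hV]
        have h1 := pow_ratio_le (n := n) hlμ hμb' hbb.le
        have h2 := one_sub_pow_pos hn hlμ hμb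
        have h3 : f b' = (v - b') * (1 - ((b' - μ) / (b' - l)) ^ (n - 1)) := by
          simp only [hf]; ring
        rw [h3]
        exact mul_le_mul (by linarith) (by linarith) h2.le (by linarith)
      refine (EReal.coe_le_coe_iff.2 hle).trans ?_
      have ht : Filter.Tendsto (fun z => (f z : EReal)) (nhdsWithin b' (Ioi b'))
          (nhds (f b' : EReal)) :=
        (continuous_coe_real_ereal.continuousAt.comp hfc).mono_left nhdsWithin_le_nhds
      refine le_of_tendsto ht ?_
      filter_upwards [Ioo_mem_nhdsGT hbb] with z hz
      have hzl : 0 < z - l := by linarith [hz.1]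
      refine le_maxLoss_twoPoint hl hv (q := (z - μ) / (z - l)) (x := l) (y := z)
        ⟨div_nonneg (by linarith [hz.1]) hzl.le, (div_le_one hzl).2 (by linarith)⟩
        ⟨le_rfl, by linarith⟩ ⟨by linarith, by linarith [hz.2, hb.2]⟩ (by field_simp; ring)
        (z := z) (by linarith) fun P hP h => ?_
      have := expectedUtility_le (i := i) (P := P) (by linarith : b' ≤ v)
      rw [h _ measurableSet_Iic, indicator_of_mem (mem_Iic.2 (by linarith)),
        indicator_of_notMem (by simp only [mem_Iic]; linarith [hz.1])] at this
      rw [h _ measurableSet_Iic, indicator_of_mem (mem_Iic.2 (by linarith)),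
        indicator_of_mem (mem_Iic.2 le_rfl)]
      simp only [Pi.one_apply, mul_one, mul_zero, add_zero, add_sub_cancel, one_pow, hf] at this ⊢
      linarith

/-- A bid is minimax for the value at which it equates the losses from over- and underbidding. -/
theorem isMinimaxBid_of_valueOf (hn : 2 ≤ n) (hl : 0 ≤ l) (hlμ : l < μ) (hμu : μ < u)
    (hb : b ∈ Icc l u) (hV : valueOf n l μ u b = v) : IsMinimaxBid i l μ u v b := by
  have hv : 0 ≤ v := hl.trans (hb.1.trans (hV ▸ le_valueOf hn hlμ hμu hb))
  refine ⟨hl.trans hb.1, fun b' _ => ?_⟩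
  rcases lt_trichotomy b' b with h | rfl | h
  · exact (maxLoss_le fun P hP x _ => expectedUtility_le_add_overLoss hn hlμ hμu hb hV hP x).trans
      (overLoss_le_maxLoss_of_lt hn hl hlμ hμu hv hb hV h)
  · exact le_rfl
  · exact (maxLoss_le fun P hP x _ => expectedUtility_le_add_overLoss hn hlμ hμu hb hV hP x).trans
      (overLoss_le_maxLoss_of_gt hn hl hlμ hμu hv hb h)

end

/-! ### The one-parameter family of beliefs under which the highest value bids u -/

open Filter Topology

/-- The highest bid, parametrized by `s = (u - μ) / (u - l)`, when the highest value is `W`. -/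
noncomputable def upperBid (n : ℕ) (l W s : ℝ) : ℝ :=
  l + (W - l) * (1 - s ^ (n - 1)) / (1 + s - s ^ (n - 1))

/-- The mean bid, parametrized by `s = (u - μ) / (u - l)`, when the highest value is `W`. -/
noncomputable def meanBid (n : ℕ) (l W s : ℝ) : ℝ :=
  l + (1 - s) * (upperBid n l W s - l)

section

variable {n : ℕ} {l W s : ℝ}

theorem one_add_sub_pow_pos (hn : 2 ≤ n) (hs : s ∈ Ico (0 : ℝ) 1) : 0 < 1 + s - s ^ (n - 1) := by
  have : s ^ (n - 1) < 1 := pow_lt_one₀ hs.1 hs.2 (by omega)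
  linarith [hs.1]

theorem continuousOn_upperBid (hn : 2 ≤ n) : ContinuousOn (upperBid n l W) (Ico 0 1) := by
  unfold upperBid
  refine ContinuousOn.add continuousOn_const (ContinuousOn.div (by fun_prop) (by fun_prop) ?_)
  exact fun s hs => (one_add_sub_pow_pos hn hs).ne'

theorem continuousOn_meanBid (hn : 2 ≤ n) : ContinuousOn (meanBid n l W) (Ico 0 1) := by
  unfold meanBid
  exact continuousOn_const.add ((by fun_prop : ContinuousOn (fun s : ℝ => 1 - s) (Ico 0 1)).mul
    ((continuousOn_upperBid hn).sub continuousOn_const))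

theorem lt_upperBid (hn : 2 ≤ n) (hlW : l < W) (hs : s ∈ Ioo (0 : ℝ) 1) : l < upperBid n l W s := by
  have h1 : s ^ (n - 1) < 1 := pow_lt_one₀ hs.1.le hs.2 (by omega)
  have := div_pos (mul_pos (sub_pos.2 hlW) (sub_pos.2 h1)) (one_add_sub_pow_pos hn ⟨hs.1.le, hs.2⟩)
  unfold upperBid
  linarith

theorem upperBid_le (hn : 2 ≤ n) (hlW : l < W) (hs : s ∈ Ioo (0 : ℝ) 1) : upperBid n l W s ≤ W := by
  have h := one_add_sub_pow_pos hn ⟨hs.1.le, hs.2⟩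
  have : (W - l) * (1 - s ^ (n - 1)) / (1 + s - s ^ (n - 1)) ≤ W - l := by
    rw [div_le_iff₀ h]
    exact mul_le_mul_of_nonneg_left (by linarith [hs.1]) (by linarith)
  unfold upperBid
  linarith

theorem lt_meanBid (hn : 2 ≤ n) (hlW : l < W) (hs : s ∈ Ioo (0 : ℝ) 1) : l < meanBid n l W s := by
  have := mul_pos (sub_pos.2 hs.2) (sub_pos.2 (lt_upperBid hn hlW hs))
  unfold meanBid
  linarith

theorem meanBid_lt_upperBid (hn : 2 ≤ n) (hlW : l < W) (hs : s ∈ Ioo (0 : ℝ) 1) :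
    meanBid n l W s < upperBid n l W s := by
  have := mul_pos hs.1 (sub_pos.2 (lt_upperBid hn hlW hs))
  unfold meanBid
  linarith

/-- Since the overbidding loss at u is u - μ = s(u - l), the equation reads u + s(u - l)/(1 -
s^(n-1)) = W, which is linear in u; `upperBid` is its solution. -/
theorem valueOf_upperBid (hn : 2 ≤ n) (hlW : l < W) (hs : s ∈ Ioo (0 : ℝ) 1) :
    valueOf n l (meanBid n l W s) (upperBid n l W s) (upperBid n l W s) = W := by
  have h1 := lt_meanBid hn hlW hs
  have h2 := meanBid_lt_upperBid hn hlW hs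
  have h3 := sub_pos.2 (lt_upperBid hn hlW hs)
  rw [valueOf_of_ge h2 h2.le, overLoss_upper hn h1.le h2]
  have e1 : upperBid n l W s - meanBid n l W s = s * (upperBid n l W s - l) := by
    unfold meanBid; ring
  rw [e1, mul_div_cancel_right₀ _ h3.ne']
  have h4 : s ^ (n - 1) < 1 := pow_lt_one₀ hs.1.le hs.2 (by omega)
  have h5 := one_add_sub_pow_pos hn ⟨hs.1.le, hs.2⟩
  have h6 : 0 < 1 - s ^ (n - 1) := by linarith
  unfold upperBid
  field_simp
  ring

theorem betaIND_bid_spec (hn : 2 ≤ n) (hlW : l < W) (hs : s ∈ Ioo (0 : ℝ) 1) {v : ℝ}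
    (hv : v ∈ Icc l W) :
    betaIND n l (meanBid n l W s) (upperBid n l W s) v ∈ Icc l (upperBid n l W s) ∧
      valueOf n l (meanBid n l W s) (upperBid n l W s)
        (betaIND n l (meanBid n l W s) (upperBid n l W s) v) = v :=
  betaIND_spec hn (lt_meanBid hn hlW hs) (meanBid_lt_upperBid hn hlW hs)
    (by rwa [valueOf_upperBid hn hlW hs])

theorem strictMonoOn_betaIND_bid (hn : 2 ≤ n) (hlW : l < W) (hs : s ∈ Ioo (0 : ℝ) 1) :
    StrictMonoOn (betaIND n l (meanBid n l W s) (upperBid n l W s)) (Icc l W) := by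
  have := strictMonoOn_betaIND hn (lt_meanBid hn hlW hs) (meanBid_lt_upperBid hn hlW hs)
  rwa [valueOf_upperBid hn hlW hs] at this

theorem lt_betaIND_of_valueOf_lt (hn : 2 ≤ n) (hlW : l < W) (hs : s ∈ Ioo (0 : ℝ) 1) {v a : ℝ}
    (hv : v ∈ Icc l W) (ha : a ∈ Icc l (upperBid n l W s))
    (h : valueOf n l (meanBid n l W s) (upperBid n l W s) a < v) :
    a < betaIND n l (meanBid n l W s) (upperBid n l W s) v := by
  obtain ⟨h1, h2⟩ := betaIND_bid_spec hn hlW hs hv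
  rw [← (strictMonoOn_valueOf hn (lt_meanBid hn hlW hs)
    (meanBid_lt_upperBid hn hlW hs)).lt_iff_lt ha h1, h2]
  exact h

theorem betaIND_lt_of_lt_valueOf (hn : 2 ≤ n) (hlW : l < W) (hs : s ∈ Ioo (0 : ℝ) 1) {v a : ℝ}
    (hv : v ∈ Icc l W) (ha : a ∈ Icc l (upperBid n l W s))
    (h : v < valueOf n l (meanBid n l W s) (upperBid n l W s) a) :
    betaIND n l (meanBid n l W s) (upperBid n l W s) v < a := by
  obtain ⟨h1, h2⟩ := betaIND_bid_spec hn hlW hs hv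
  rw [← (strictMonoOn_valueOf hn (lt_meanBid hn hlW hs)
    (meanBid_lt_upperBid hn hlW hs)).lt_iff_lt h1 ha, h2]
  exact h

/-- Inverses of a continuous family of strictly increasing functions: comparing the bid with a is
comparing v with `valueOf` at a, an open condition on the parameter. -/
theorem continuousAt_betaIND_bid (hn : 2 ≤ n) (hlW : l < W) (hs : s ∈ Ioo (0 : ℝ) 1) {v : ℝ}
    (hv : v ∈ Icc l W) :
    ContinuousAt (fun t => betaIND n l (meanBid n l W t) (upperBid n l W t) v) s := by
  have hnhds : Ico (0 : ℝ) 1 ∈ 𝓝 s := mem_of_superset (Ioo_mem_nhds hs.1 hs.2) Ioo_subset_Ico_self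
  have hu : ContinuousAt (upperBid n l W) s := (continuousOn_upperBid hn).continuousAt hnhds
  have hm : ContinuousAt (meanBid n l W) s := (continuousOn_meanBid hn).continuousAt hnhds
  have hV : ∀ a, ContinuousAt (fun t => valueOf n l (meanBid n l W t) (upperBid n l W t) a) s := by
    intro a
    exact (continuousAt_valueOf hn (lt_meanBid hn hlW hs) (meanBid_lt_upperBid hn hlW hs) a).comp
      (f := fun t => (meanBid n l W t, upperBid n l W t, a))
      (hm.prodMk (hu.prodMk continuousAt_const))
  have hev : ∀ᶠ t in 𝓝 s, t ∈ Ioo (0 : ℝ) 1 := Ioo_mem_nhds hs.1 hs.2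
  obtain ⟨h1, h2⟩ := betaIND_bid_spec hn hlW hs hv
  have hmono := strictMonoOn_valueOf hn (lt_meanBid hn hlW hs) (meanBid_lt_upperBid hn hlW hs)
  rw [ContinuousAt, tendsto_order]
  constructor
  · intro a ha
    rcases lt_or_ge a l with hal | hla
    · filter_upwards [hev] with t ht
      exact hal.trans_le (betaIND_bid_spec hn hlW ht hv).1.1
    · have h3 := hmono ⟨hla, ha.le.trans h1.2⟩ h1 ha
      rw [h2] at h3
      filter_upwards [hev, (hV a).eventually_lt_const h3,
        hu.eventually_const_lt (ha.trans_le h1.2)] with t ht h4 h5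
      exact lt_betaIND_of_valueOf_lt hn hlW ht hv ⟨hla, h5.le⟩ h4
  · intro a ha
    rcases lt_or_ge (upperBid n l W s) a with hua | hau
    · filter_upwards [hev, hu.eventually_lt_const hua] with t ht h4
      exact (betaIND_bid_spec hn hlW ht hv).1.2.trans_lt h4
    -- Here a may equal the upper bid at s and leave the range for nearby t; a smaller c stays
    -- inside.
    · obtain ⟨c, hbc, hca⟩ := exists_between ha
      have h3 := hmono h1 ⟨h1.1.trans hbc.le, hca.le.trans hau⟩ hbc
      rw [h2] at h3
      filter_upwards [hev, (hV c).eventually_const_lt h3,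
        hu.eventually_const_lt (hca.trans_le hau)] with t ht h4 h5
      exact (betaIND_lt_of_lt_valueOf hn hlW ht hv ⟨h1.1.trans hbc.le, h5.le⟩ h4).trans hca

/-! ### Matching the mean bid by the intermediate value theorem -/

variable {F : Measure ℝ}

theorem ae_mem_Icc_of_support (hlo : IsLeast F.support l) (hhi : IsGreatest F.support W) :
    ∀ᵐ v ∂F, v ∈ Icc l W := by
  filter_upwards [Measure.support_mem_ae (μ := F)] with v hv
  exact ⟨hlo.2 hv, hhi.2 hv⟩

theorem aemeasurable_betaIND_bid (hn : 2 ≤ n) (hlW : l < W) (hF : ∀ᵐ v ∂F, v ∈ Icc l W)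
    (hs : s ∈ Ioo (0 : ℝ) 1) :
    AEMeasurable (betaIND n l (meanBid n l W s) (upperBid n l W s)) F := by
  have := aemeasurable_restrict_of_monotoneOn (μ := F) measurableSet_Icc
    (strictMonoOn_betaIND_bid hn hlW hs).monotoneOn
  rwa [Measure.restrict_eq_self_of_ae_mem hF] at this

variable [IsProbabilityMeasure F]

theorem integrable_betaIND_bid (hn : 2 ≤ n) (hlW : l < W) (hF : ∀ᵐ v ∂F, v ∈ Icc l W)
    (hs : s ∈ Ioo (0 : ℝ) 1) :
    Integrable (betaIND n l (meanBid n l W s) (upperBid n l W s)) F := by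
  refine Integrable.of_mem_Icc l (upperBid n l W s) (aemeasurable_betaIND_bid hn hlW hF hs) ?_
  filter_upwards [hF] with v hv using (betaIND_bid_spec hn hlW hs hv).1

theorem continuousOn_integral_betaIND_bid (hn : 2 ≤ n) (hlW : l < W) (hF : ∀ᵐ v ∂F, v ∈ Icc l W) :
    ContinuousOn (fun t => ∫ v, betaIND n l (meanBid n l W t) (upperBid n l W t) v ∂F)
      (Ioo 0 1) := by
  intro s hs
  refine ContinuousAt.continuousWithinAt ?_
  have hev : ∀ᶠ t in 𝓝 s, t ∈ Ioo (0 : ℝ) 1 := Ioo_mem_nhds hs.1 hs.2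
  refine continuousAt_of_dominated (bound := fun _ => max |l| |W|) ?_ ?_ (integrable_const _) ?_
  · filter_upwards [hev] with t ht using (aemeasurable_betaIND_bid hn hlW hF ht).aestronglyMeasurable
  · filter_upwards [hev] with t ht
    filter_upwards [hF] with v hv
    obtain ⟨h1, -⟩ := betaIND_bid_spec hn hlW ht hv
    rw [Real.norm_eq_abs]
    exact abs_le_max_abs_abs h1.1 (h1.2.trans (upperBid_le hn hlW ht))
  · filter_upwards [hF] with v hv using continuousAt_betaIND_bid hn hlW hs hv

theorem real_pos_of_mem_support {x : ℝ} (hx : x ∈ F.support) {U : Set ℝ} (hU : U ∈ 𝓝 x) :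
    0 < F.real U :=
  ENNReal.toReal_pos ((Measure.mem_support_iff_forall x).1 hx U hU).ne' (measure_ne_top _ _)

theorem integral_id_lt (hlo : IsLeast F.support l) (hhi : IsGreatest F.support W) (hlW : l < W) :
    ∫ v, v ∂F < W := by
  have hF := ae_mem_Icc_of_support hlo hhi
  obtain ⟨c, hlc, hcW⟩ := exists_between hlW
  have hp := real_pos_of_mem_support hlo.1 (Iio_mem_nhds hlc)
  have hi : Integrable (fun v : ℝ => v) F := Integrable.of_mem_Icc l W aemeasurable_id hF
  have h1 : F.real (Iio c) • (W - c) ≤ ∫ v, (W - v) ∂F := by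
    rw [← integral_indicator_const _ measurableSet_Iio]
    refine integral_mono_ae ((integrable_const _).indicator measurableSet_Iio)
      ((integrable_const W).sub hi) ?_
    filter_upwards [hF] with v hv
    by_cases h : v ∈ Iio c
    · rw [indicator_of_mem h]
      simp only [mem_Iio] at h
      linarith
    · rw [indicator_of_notMem h]
      linarith [hv.2]
  rw [integral_sub (integrable_const W) hi, smul_eq_mul] at h1
  simp only [integral_const, probReal_univ, smul_eq_mul, one_mul] at h1
  have := mul_pos hp (sub_pos.2 hcW)
  linarith

/-- Bids never exceed values, so the average bid is at most the mean value, which is below W, the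
limit of `meanBid` as s → 0. -/
theorem exists_integral_lt_meanBid (hn : 2 ≤ n) (hlo : IsLeast F.support l)
    (hhi : IsGreatest F.support W) (hlW : l < W) :
    ∃ s ∈ Ioo (0 : ℝ) 1,
      ∫ v, betaIND n l (meanBid n l W s) (upperBid n l W s) v ∂F < meanBid n l W s := by
  have hF := ae_mem_Icc_of_support hlo hhi
  have h0 : meanBid n l W 0 = W := by
    simp [meanBid, upperBid, zero_pow (show n - 1 ≠ 0 by omega)]
  have hc : Tendsto (meanBid n l W) (𝓝[>] 0) (𝓝 W) := by
    have h1 : ContinuousWithinAt (meanBid n l W) (Ico 0 1) 0 :=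
      continuousOn_meanBid hn 0 ⟨le_rfl, one_pos⟩
    rw [ContinuousWithinAt, h0] at h1
    rw [← nhdsWithin_Ioo_eq_nhdsGT (one_pos : (0 : ℝ) < 1)]
    exact h1.mono_left (nhdsWithin_mono _ Ioo_subset_Ico_self)
  obtain ⟨s, h1, hs⟩ := ((hc.eventually_const_lt (integral_id_lt hlo hhi hlW)).and
    (Ioo_mem_nhdsGT (one_pos : (0 : ℝ) < 1))).exists
  refine ⟨s, hs, lt_of_le_of_lt ?_ h1⟩
  refine integral_mono_ae (integrable_betaIND_bid hn hlW hF hs)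
    (Integrable.of_mem_Icc l W aemeasurable_id hF) ?_
  filter_upwards [hF] with v hv
  obtain ⟨h2, h3⟩ := betaIND_bid_spec hn hlW hs hv
  exact (le_valueOf hn (lt_meanBid hn hlW hs) (meanBid_lt_upperBid hn hlW hs) h2).trans h3.le

theorem exists_meanBid_lt_integral (hn : 2 ≤ n) (hlo : IsLeast F.support l)
    (hhi : IsGreatest F.support W) (hlW : l < W) :
    ∃ s ∈ Ioo (0 : ℝ) 1,
      meanBid n l W s < ∫ v, betaIND n l (meanBid n l W s) (upperBid n l W s) v ∂F := by
  have hF := ae_mem_Icc_of_support hlo hhi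
  obtain ⟨c, hlc, hcW⟩ := exists_between hlW
  have hp := real_pos_of_mem_support hhi.1 (Ioi_mem_nhds hcW)
  have hp1 : F.real (Ioi c) ≤ 1 := measureReal_le_one
  set p := F.real (Ioi c) with hpdef
  have ht : Tendsto (fun s : ℝ => (1 - s) * (W - l) / p * (1 + 1 / p)) (𝓝[<] 1) (𝓝 0) := by
    have h : Continuous fun s : ℝ => (1 - s) * (W - l) / p * (1 + 1 / p) := by fun_prop
    have h1 := h.tendsto 1
    rw [sub_self, zero_mul, zero_div, zero_mul] at h1
    exact h1.mono_left nhdsWithin_le_nhds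
  obtain ⟨s, ⟨h1, h2⟩, hs⟩ := (((ht.eventually_lt_const (sub_pos.2 hlc)).and
    (Ioo_mem_nhdsLT (by linarith : 1 - p < 1))).and (Ioo_mem_nhdsLT (one_pos : (0 : ℝ) < 1))).exists
  refine ⟨s, hs, ?_⟩
  have k1 := lt_meanBid hn hlW hs
  have k2 := meanBid_lt_upperBid hn hlW hs
  have k3 := upperBid_le hn hlW hs
  have k4 := lt_upperBid hn hlW hs
  have k5 : meanBid n l W s - l = (1 - s) * (upperBid n l W s - l) := by unfold meanBid; ring
  have hβ := strictMonoOn_betaIND_bid hn hlW hs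
  have hspec := fun v (hv : v ∈ Icc l W) => betaIND_bid_spec hn hlW hs hv
  have hint := integrable_betaIND_bid hn hlW hF hs
  have hlt := fun a ha => lt_betaIND_of_valueOf_lt (a := a) hn hlW hs ⟨hlc.le, hcW.le⟩ ha
  set μ := meanBid n l W s
  set u := upperBid n l W s
  set β := betaIND n l μ u
  -- b is chosen so that p(b - l) = μ - l: once values above c, which have mass p, bid more than b,
  -- the average bid exceeds μ. As (b - μ)/(b - l) = 1 - p, the excess of `valueOf` at b over l is
  -- at most (b - l)(1 + 1/p), which vanishes as s → 1.
  obtain ⟨b, hb⟩ : ∃ b, b = l + (μ - l) / p := ⟨_, rfl⟩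
  have hbl : (b - l) * p = μ - l := by rw [hb]; field_simp; ring
  have hbl0 : 0 < b - l := by
    rw [hb, add_sub_cancel_left]; exact div_pos (by linarith) hp
  have hμb : μ ≤ b := by nlinarith
  have hbu : b ≤ u := by
    have : (μ - l) / p ≤ u - l := by
      rw [div_le_iff₀ hp, k5, mul_comm]
      exact mul_le_mul_of_nonneg_left (by linarith [h2.1]) (by linarith)
    linarith
  have hbs : b - l ≤ (1 - s) * (W - l) / p := by
    rw [hb, add_sub_cancel_left, k5]
    have : 0 ≤ 1 - s := by linarith [hs.2]
    gcongr
  have hVb : valueOf n l μ u b < c := by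
    have e : (b - μ) / (b - l) = 1 - p := by
      rw [div_eq_iff hbl0.ne']; linarith
    have hpow : (1 - p) ^ (n - 1) ≤ 1 - p :=
      pow_le_of_le_one (by linarith) (by linarith) (by omega)
    have hO := overLoss_le_sub (b := b) hn k1.le k2 (by linarith)
    have hd : overLoss n l μ u b / (1 - (1 - p) ^ (n - 1)) ≤ (b - l) / p :=
      div_le_div₀ hbl0.le hO hp (by linarith)
    rw [valueOf_of_ge k2 hμb, e]
    have e2 : (b - l) * (1 + 1 / p) = (b - l) + (b - l) / p := by ring
    have : (b - l) * (1 + 1 / p) ≤ (1 - s) * (W - l) / p * (1 + 1 / p) :=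
      mul_le_mul_of_nonneg_right hbs (by positivity)
    linarith
  have hbβ : b < β c := hlt b ⟨by linarith, hbu⟩ hVb
  have h3 : p • (β c - l) ≤ ∫ v, (β v - l) ∂F := by
    rw [hpdef, ← integral_indicator_const _ measurableSet_Ioi]
    refine integral_mono_ae ((integrable_const _).indicator measurableSet_Ioi)
      (hint.sub (integrable_const l)) ?_
    filter_upwards [hF] with v hv
    by_cases h : v ∈ Ioi c
    · rw [indicator_of_mem h]
      have := hβ.monotoneOn ⟨hlc.le, hcW.le⟩ hv (le_of_lt h)
      linarith
    · rw [indicator_of_notMem h]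
      linarith [(hspec v hv).1.1]
  rw [integral_sub hint (integrable_const l), smul_eq_mul] at h3
  simp only [integral_const, probReal_univ, smul_eq_mul, one_mul] at h3
  have := mul_lt_mul_of_pos_left hbβ hp
  nlinarith

theorem exists_integral_eq_meanBid (hn : 2 ≤ n) (hlo : IsLeast F.support l)
    (hhi : IsGreatest F.support W) (hlW : l < W) :
    ∃ s ∈ Ioo (0 : ℝ) 1,
      ∫ v, betaIND n l (meanBid n l W s) (upperBid n l W s) v ∂F = meanBid n l W s := by
  obtain ⟨s₀, hs₀, h₀⟩ := exists_integral_lt_meanBid hn hlo hhi hlW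
  obtain ⟨s₁, hs₁, h₁⟩ := exists_meanBid_lt_integral hn hlo hhi hlW
  exact isPreconnected_Ioo.intermediate_value₂ hs₀ hs₁
    (continuousOn_integral_betaIND_bid hn hlW (ae_mem_Icc_of_support hlo hhi))
    ((continuousOn_meanBid hn).mono Ioo_subset_Ico_self) h₀.le h₁.le

end

end FirstPriceAuction

theorem theorem2 (n : ℕ) (hn : 2 ≤ n) (F : Measure ℝ) [IsProbabilityMeasure F]
    (vlo vhi : ℝ) (hlo : IsLeast F.support vlo) (hhi : IsGreatest F.support vhi)
    (h0 : 0 ≤ vlo) (hlt : vlo < vhi) :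
    ∃ l μ u : ℝ,
      FirstPriceAuction.IsMomentEquilibrium F
        (fun _ : Fin n => FirstPriceAuction.betaIND n l μ u)
        (fun _ => l) (fun _ => μ) (fun _ => u) ∧
      StrictMonoOn (FirstPriceAuction.betaIND n l μ u) (Set.Icc vlo vhi) := by
  open FirstPriceAuction in
  obtain ⟨s, hs, hmean⟩ := exists_integral_eq_meanBid hn hlo hhi hlt
  have k1 := lt_meanBid hn hlt hs
  have k2 := meanBid_lt_upperBid hn hlt hs
  have k3 := valueOf_upperBid hn hlt hs
  have hmono := strictMonoOn_betaIND_bid hn hlt hs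
  have hsub : ∀ v ∈ F.support, v ∈ Set.Icc vlo vhi := fun v hv => ⟨hlo.2 hv, hhi.2 hv⟩
  have hspec := fun v hv => betaIND_bid_spec hn hlt hs (hsub v hv)
  refine ⟨vlo, meanBid n vlo vhi s, upperBid n vlo vhi s, ⟨?_, ?_, ?_, ?_, ?_, ?_⟩, hmono⟩
  · exact fun _ => ⟨h0, by linarith⟩
  · intro _
    -- Monotonicity is known only on the interval of values, which suffices since strategies live on
    -- the support.
    refine Monotone.measurable fun v w hvw => ?_
    exact hmono.monotoneOn (hsub v v.2) (hsub w w.2) hvw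
  · exact fun _ v hv => isMinimaxBid_of_valueOf hn h0 k1 k2 (hspec v hv).1 (hspec v hv).2
  · exact fun _ _ _ => hmean
  · refine fun _ _ _ => IsLeast.isGLB ⟨⟨vlo, hlo.1, ?_⟩, ?_⟩
    · refine valueOf_betaIND_unique hn k1 k2 ?_ ⟨le_rfl, by linarith⟩ (valueOf_lower hn k1.le k2)
      rw [k3]
      exact hsub _ hlo.1
    · rintro _ ⟨v, hv, rfl⟩
      exact (hspec v hv).1.1
  · refine fun _ _ _ => IsGreatest.isLUB ⟨⟨vhi, hhi.1, ?_⟩, ?_⟩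
    · refine valueOf_betaIND_unique hn k1 k2 ?_ ⟨by linarith, le_rfl⟩ k3
      rw [k3]
      exact hsub _ hhi.1
    · rintro _ ⟨v, hv, rfl⟩
      exact (hspec v hv).1.2
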